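/- **The algorithm.** Let $G=(V,E)$ be a finite simple graph with $n$ vertices and maximum degree $\Delta$, let $\epsilon\in(0,1)$, let $\kappa,\ell\in\mathbb N$, and put $q=\lfloor(1+\epsilon/2)\Delta\rfloor$. A state $\phi$ marks each edge as blank (uncolored), flagged, or colored with a color of $[q]=\{1,\dots,q\}$; write $M(\phi,x)$ for the set of colors of $[q]$ that appear on no edge at $x$. Stage 1 starts with all edges blank and $U=E$. While $U\neq\varnothing$: pick an edge $e=xy\in U$ and an endpoint $x\in e$ uniformly at random, update $\phi$ by running $\mathsf{ColorOne}$ on $(\phi,e,x)$, and remove from $U$ the picked edge $e$. $\mathsf{ColorOne}(\phi,e,x)$: let $Q=[q]$. Repeat at most $\lfloor 100\log\Delta\rfloor$ times: 1. Let $C$ be the set of colors obtained by drawing $\kappa$ times uniformly, independently and with replacement from $Q$; replace $Q$ by $Q\setminus C$. 2. *(Fan)* With $e=xy$, let $y_0=y$, $k=1$. Repeat: if $M(\phi,y_{k-1})\cap C=\varnothing$, flag $e$ and stop $\mathsf{ColorOne}$. Otherwise let $\alpha=\min (M(\phi,y_{k-1})\cap C)$. If $\alpha\in M(\phi,x)$,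 end the fan construction with $P=(x)$. Otherwise let $z$ be the vertex with $\phi(xz)=\alpha$; if $z\in\{y_0,\dots,y_{k-1}\}$, end the fan construction; if not, put $y_k=z$ and increase $k$ by 1. The fan is $F=(x,y_0,\dots,y_{k-1})$. 3. *(Path)* If $P$ has not been set in the current round: if $M(\phi,x)\cap C=\varnothing$, flag $e$ and stop $\mathsf{ColorOne}$; otherwise let $\beta=\min(M(\phi,x)\cap C)$ and let $P=(x_0=x,x_1,\dots,x_s)$ be the path from $x$ whose edges are colored $\alpha,\beta,\alpha,\dots$, followed as long as possible but for at most $\ell$ edges. Let $F'=(x,y_0,\dots,y_{j-1})$, where $y_j=x_1$; if $P=(x)$, let $F'=F$. 4. If $P$ has fewer than $\ell$ edges: interchange $\alpha$ and $\beta$ along $P$; then shift $F$ if the last vertex of $P$ is the last vertex of $F'$, and shift $F'$ otherwise; color the last edge of the shifted fan with $\alpha$; stop $\mathsf{ColorOne}$. (Shifting a fan $(x,y_0,\dots,y_{r-1})$ gives each $xy_i$ with $i<r-1$ the color of $xy_{i+1}$ and makes $xy_{r-1}$ blank.) 5. If $P$ has $\ell$ edges: pick $\ell'\in[\ell]$ uniformly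 at random, uncolor $x_{\ell'-1}x_{\ell'}$, interchange $\alpha$ and $\beta$ along $(x_0,\dots,x_{\ell'-1})$, shift $F'$, color the last edge of $F'$ with $\alpha$, and continue with $e=x_{\ell'-1}x_{\ell'}$ and $x=x_{\ell'-1}$. If all rounds are used up, flag the current edge $e$. All random choices are independent. After Stage 1, let $G^*$ be the subgraph formed by the flagged edges. The algorithm reaches its FAIL step if and only if $\Delta(G^*)>\epsilon\Delta/6$. **Proposition.** There are constants $a_0,b_0>0$ such that for all $a_1\ge a_0$, $b_1\ge b_0$ and $A>0$ there is a constant $K>0$ with the following property. Let $\epsilon\in(0,1)$, and let $G$ be an $n$-vertex simple graph of maximum degree $\Delta$ with $$\Delta\ \ge\ K\max\left\{\frac{\log n}{\epsilon},\ \left(\frac1\epsilon\log\frac1\epsilon\right)^2\right\}.$$ Let $\kappa,\ell\in\mathbb N$ satisfy $a_0\frac{\log\Delta}{\epsilon}\le\kappa\le a_1\frac{\log\Delta}{\epsilon}$ and $b_0\kappa^2\le\ell\le b_1\kappa^2$. Then $$\Pr[\text{the algorithm reaches its FAIL step}]\ =\ \Pr\left[\Delta(G^*)>\epsilon\Delta/6\right]\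 \le\ n^{-A}.$$ -/

import Mathlib

/-!
The randomized two-stage edge-coloring algorithm (its first stage, up to and including the test
that decides whether the algorithm fails), written as a probability mass function.
-/

namespace EdgeColoring

/-- The entry of the coloring table at an edge: uncolored, flagged, or a colour in `[q]`. -/
inductive Status where
  | blank : Status
  | flg : Status
  | color (c : ℕ) : Status
  deriving DecidableEq

/-- A partial coloring together with the flags (only the values on edges matter). -/
abbrev Coloring (V : Type*) := Sym2 V → Status

/-- The uniform distribution on `s`; `s` is non-empty wherever the algorithm samples. -/
noncomputable def uniformOn {α : Type*} (s : Finset α) (default : α) : PMF α :=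
  open Classical in
  if h : s.Nonempty then PMF.uniformOfFinset s h else PMF.pure default

/-- The random set of colours obtained by drawing `κ` times, uniformly and independently,
with replacement, from `Q`. -/
noncomputable def samplePalette (Q : Finset ℕ) : ℕ → PMF (Finset ℕ)
  | 0 => PMF.pure ∅
  | κ + 1 => (uniformOn Q 0).bind fun c => (samplePalette Q κ).bind fun C =>
      PMF.pure (insert c C)

/-- The edges `x₀x₁, x₁x₂, …` of a vertex sequence `x₀, x₁, …`. -/
def pathEdges {V : Type*} (P : List V) : List (Sym2 V) :=
  List.zipWith (fun a b => s(a, b)) P P.tail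

section Algorithm

variable {V : Type*} [DecidableEq V]

/-- Flipping: interchange the colours `α` and `β` on the edges of `P`. -/
def flipPath (φ : Coloring V) (P : List V) (α β : ℕ) : Coloring V := fun e =>
  if e ∈ pathEdges P then
    if φ e = Status.color α then Status.color β
    else if φ e = Status.color β then Status.color α
    else φ e
  else φ e

/-- Shifting the fan `(x, y₀, …, y_{k-1})`: the edge `x yᵢ` receives the colour of `x yᵢ₊₁`, and
the last edge becomes blank. -/
def shiftFan (φ : Coloring V) (x : V) : List V → Coloring V
  | [] => φ
  | [y] => Function.update φ s(x, y) Status.blank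
  | y :: z :: ys => shiftFan (Function.update φ s(x, y) (φ s(x, z))) x (z :: ys)

/-- Shift the fan `(x, y₀, …, y_{k-1})` and then colour its last edge `x y_{k-1}` with `α`. -/
def shiftAndColor (φ : Coloring V) (x : V) (ys : List V) (α : ℕ) : Coloring V :=
  match ys.getLast? with
  | none => φ
  | some y => Function.update (shiftFan φ x ys) s(x, y) (Status.color α)

/-- `F' = (x, y₀, …, y_{j-1})` if `y_j = x₁` is the second vertex of `P`; `F' = F` if there is
no such `j`. The fan is given by the list of its `yᵢ`. -/
def cutFan (ys : List V) (P : List V) : List V :=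
  match P[1]? with
  | none => ys
  | some x₁ => ys.take (ys.idxOf x₁)

/-- A Vizing chain `(F, P)` (the pivot of `F` is known from the context, `ys` lists the other
vertices of `F`), with the colours `α`, `β` of its path. -/
structure VizingChain (V : Type*) where
  ys : List V
  path : List V
  α : ℕ
  β : ℕ

/-- The augmenting algorithm. -/
def augment (φ : Coloring V) (x : V) (K : VizingChain V) : Coloring V :=
  let F' := cutFan K.ys K.path
  let ψ := flipPath φ K.path K.α K.β
  if K.path.getLast? = F'.getLast? then shiftAndColor ψ x K.ys K.α
  else shiftAndColor ψ x F' K.α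

/-- The update of the coloring when the uncolored edge is moved to `x_{ℓ'-1} x_{ℓ'}`: uncolor that
edge, flip `P' = (x₀, …, x_{ℓ'-1})`, shift `F'`, and colour the last edge of `F'` with `α`. -/
def moveUncolored (φ : Coloring V) (x : V) (K : VizingChain V) (ℓ' : ℕ) : Coloring V :=
  let a := K.path.getD (ℓ' - 1) x
  let b := K.path.getD ℓ' x
  let φ₁ := Function.update φ s(a, b) Status.blank
  let φ₂ := flipPath φ₁ (K.path.take ℓ') K.α K.β
  shiftAndColor φ₂ x (cutFan K.ys K.path) K.α

variable [Fintype V] (G : SimpleGraph V) [DecidableRel G.Adj] (q : ℕ)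

/-- `M(φ, x)`: the colours of `[q]` that appear on no edge at `x`. -/
def missing (φ : Coloring V) (x : V) : Finset ℕ :=
  (Finset.Icc 1 q).filter fun c => ∀ y, G.Adj x y → φ s(x, y) ≠ Status.color c

/-- The neighbour `y` of `x` with `φ(xy) = c`, if there is one (it is unique when `φ` is proper). -/
noncomputable def nbrAt (φ : Coloring V) (x : V) (c : ℕ) : Option V :=
  if h : ∃ y, G.Adj x y ∧ φ s(x, y) = Status.color c then some h.choose else none

/-- The loop of the fan construction: `ys` lists the vertices `y₀, …, y_{k-1}` found so far and `z`
is the last of them. The result `none` means failure; otherwise it is `(ys, η, j)`. -/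
noncomputable def makeFanLoop (φ : Coloring V) (x : V) (C : Finset ℕ) (ys : List V) (z : V) :
    Option (List V × ℕ × ℕ) :=
  if h : (missing G q φ z ∩ C).Nonempty then
    let η := (missing G q φ z ∩ C).min' h
    match nbrAt G φ x η with
    | none => some (ys, η, ys.length)
    | some w =>
      if w ∈ ys then some (ys, η, ys.idxOf w)
      else makeFanLoop φ x C (ys ++ [w]) w
  else none
termination_by (Finset.univ \ ys.toFinset).card
decreasing_by
  apply Finset.card_lt_card
  refine Finset.ssubset_iff_subset_ne.2 ⟨?_, ?_⟩
  · intro a ha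
    simp only [List.toFinset_append, Finset.mem_sdiff, Finset.mem_univ, true_and,
      Finset.mem_union, not_or, List.mem_toFinset] at ha ⊢
    exact ha.1
  · intro heq
    have hw : w ∈ Finset.univ \ ys.toFinset := by simpa using ‹¬ w ∈ ys›
    rw [← heq] at hw
    simp at hw

/-- The fan construction for the uncolored edge `xy` with pivot `x` and palette `C`. -/
noncomputable def makeFan (φ : Coloring V) (x y : V) (C : Finset ℕ) :
    Option (List V × ℕ × ℕ) :=
  makeFanLoop G q φ x C [y] y

/-- The path that starts at `v` and follows edges coloured `c, c', c, c', …` as long as possible,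
but for at most the given number of edges. -/
noncomputable def altPath (φ : Coloring V) (v : V) (c c' : ℕ) : ℕ → List V
  | 0 => [v]
  | s + 1 =>
    match nbrAt G φ v c with
    | none => [v]
    | some w => v :: altPath φ w c' c s

/-- The Vizing chain algorithm for the uncolored edge `xy` with pivot `x`, palette `C` and length
bound `ℓ`; `none` means failure. (If the path is trivial, the field `β` is irrelevant.) -/
noncomputable def vizingChain (φ : Coloring V) (x y : V) (C : Finset ℕ) (ℓ : ℕ) :
    Option (VizingChain V) :=
  match makeFan G q φ x y C with
  | none => none
  | some (ys, α, j) =>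
    if j = ys.length then some ⟨ys, [x], α, α⟩
    else if h : (missing G q φ x ∩ C).Nonempty then
      let β := (missing G q φ x ∩ C).min' h
      some ⟨ys, altPath G φ x α β ℓ, α, β⟩
    else none

/-- The loop of the algorithm that processes one edge. The first argument is the number of rounds
left, `Q` the set of colours not sampled so far, `xy` the current uncolored edge, `x` its pivot. -/
noncomputable def colorOneLoop (κ ℓ : ℕ) :
    ℕ → Coloring V → Finset ℕ → V → V → PMF (Coloring V)
  | 0, φ, _, x, y => PMF.pure (Function.update φ s(x, y) Status.flg)
  | t + 1, φ, Q, x, y =>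
    (samplePalette Q κ).bind fun C =>
      match vizingChain G q φ x y C ℓ with
      | none => PMF.pure (Function.update φ s(x, y) Status.flg)
      | some K =>
        if K.path.length - 1 < ℓ then PMF.pure (augment φ x K)
        else (uniformOn (Finset.Icc 1 ℓ) 1).bind fun ℓ' =>
          colorOneLoop κ ℓ t (moveUncolored φ x K ℓ') (Q \ C)
            (K.path.getD (ℓ' - 1) x) (K.path.getD ℓ' x)

/-- Processing the uncolored edge `xy` with pivot `x`: all of `[q]` is available at the start, and
there are at most `T` rounds. -/
noncomputable def colorOne (κ ℓ T : ℕ) (φ : Coloring V) (x y : V) : PMF (Coloring V) :=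
  colorOneLoop G q κ ℓ T φ (Finset.Icc 1 q) x y

theorem nonempty_oriented {W : Type*} {U : Finset (Sym2 W)} (h : U.Nonempty) :
    Nonempty {p : W × W // s(p.1, p.2) ∈ U} := by
  obtain ⟨e, he⟩ := h
  induction e with
  | _ a b => exact ⟨⟨(a, b), he⟩⟩

/-- The while-loop of the main algorithm. A uniformly random edge `e ∈ U` together with a uniformly
random vertex `x ∈ e` is a uniformly random pair `(x, y)` with `xy ∈ U`. -/
noncomputable def mainLoop (κ ℓ T : ℕ) (φ : Coloring V) (U : Finset (Sym2 V)) :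
    PMF (Coloring V) :=
  if h : U.Nonempty then
    haveI := nonempty_oriented h
    (PMF.uniformOfFintype {p : V × V // s(p.1, p.2) ∈ U}).bind fun p =>
      (colorOne G q κ ℓ T φ p.1.1 p.1.2).bind fun φ' =>
        mainLoop κ ℓ T φ' (U.erase s(p.1.1, p.1.2))
  else PMF.pure φ
termination_by U.card
decreasing_by exact Finset.card_erase_lt_of_mem p.2

/-- The law of the table of colours and flags when the while-loop of the main algorithm ends; there
are `⌊(1 + ε/2) Δ⌋` colours and `⌊100 log Δ⌋` rounds for each edge. -/
noncomputable def stageOne (ε : ℝ) (κ ℓ : ℕ) : PMF (Coloring V) :=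
  mainLoop G ⌊(1 + ε / 2) * (G.maxDegree : ℝ)⌋₊ κ ℓ ⌊100 * Real.log (G.maxDegree : ℝ)⌋₊
    (fun _ => Status.blank) G.edgeFinset

/-- `G*`: the subgraph formed by the flagged edges. -/
def flaggedGraph (φ : Coloring V) : SimpleGraph V where
  Adj a b := G.Adj a b ∧ φ s(a, b) = Status.flg
  symm := ⟨fun a b h => ⟨h.1.symm, Sym2.eq_swap (a := a) (b := b) ▸ h.2⟩⟩
  loopless := ⟨fun a h => G.loopless.irrefl a h.1⟩

instance (φ : Coloring V) : DecidableRel (flaggedGraph G φ).Adj := fun a b =>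
  inferInstanceAs (Decidable (G.Adj a b ∧ φ s(a, b) = Status.flg))

/-- The outcomes of the first stage for which the main algorithm reaches its FAIL step:
`Δ(G*) > ε Δ / 6`. -/
def failEvent (ε : ℝ) : Set (Coloring V) :=
  {φ | ε * (G.maxDegree : ℝ) / 6 < ((flaggedGraph G φ).maxDegree : ℝ)}

end Algorithm

end EdgeColoring

/-!
A flag appears only if a palette misses all colours of some set `M(φ, z)`, or if the uncolored edge
is moved in all of the `T` rounds. The proof bounds, for every vertex `v`, the probability that
the processing of one edge ends with a flag at `v`.

*The positions depend on the initial coloring only.* A round changes no colour outside its palette,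
and the palettes of different rounds are disjoint. Hence the fans and alternating paths of all
rounds can be computed from the coloring `φ₀` before the edge was processed (`vizingChain_congr`,
`RoundState`), and the positions (uncolored edge, pivot) form a Markov process on a fixed proper
coloring. That the coloring stays proper is the usual analysis of Vizing chains
(`IsVizingChain.augment`, `IsVizingChain.moveUncolored`).

*Every move halves the weight at a vertex.* Give every position a weight, and let `m` be the largest
total weight at a vertex. For an ordered pair `(α, β)` of palette colours, at most two
`αβ`-paths that start at a vertex missing `β` visit a given vertex `v`, one for each parity
of the position of `v` on the path, since the parity determines the colour by which the path enters
`v` (`IsAltWalk.eq_of_parity`, `sum_card_visits_le`). As `ℓ'` is uniform on `ℓ` values, the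
total weight at `v` after the move is at most `2 κ² m / ℓ ≤ m / 2` (`sum_moveExpect_le`). So if the
positions are weighted by `1` for every orientation of an edge in `U`, with `m ≤ Δ`, the weight of
the flags at `v` is at most `Δ (4 (Δ + 2) ρ ^ κ + 2 · 2 ^ (-T)) ≤ 2`, where `(Δ + 2) ρ ^ κ` bounds
the probability that a palette misses one of the sets `M(φ, z)` in question (`sum_flagMass_le`).
Consequently a random edge of `U` leads to a flag at `v` with probability at most `1 / |U|`.

*Concentration.* If `N` is the number of flags at `v`, a step with `|U| = u` multiplies the bound for
`E[2 ^ N]` by at most `1 + 1 / u`, so that `E[2 ^ N] ≤ |E| + 1 ≤ n²` in the end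
(`expect_mainLoop_le`). Markov's inequality and a union bound over the vertices give the failure
probability `n³ 2 ^ (-ε Δ / 6)`, and `ε Δ ≥ K log n`.
-/

namespace EdgeColoring

open scoped ENNReal

/-! ### Expectations under probability mass functions -/

/-- The expectation of an extended non-negative function under a probability mass function. -/
noncomputable def expect {α : Type*} (p : PMF α) (f : α → ℝ≥0∞) : ℝ≥0∞ := ∑' a, p a * f a

section Expect

variable {α β : Type*}

theorem expect_pure (a : α) (f : α → ℝ≥0∞) : expect (PMF.pure a) f = f a := by
  classical
  unfold expect
  rw [tsum_eq_single a]
  · simp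
  · intro b hb
    simp [hb]

theorem expect_bind (p : PMF α) (g : α → PMF β) (f : β → ℝ≥0∞) :
    expect (p.bind g) f = expect p fun a => expect (g a) f := by
  unfold expect
  simp only [PMF.bind_apply]
  simp_rw [← ENNReal.tsum_mul_right]
  rw [ENNReal.tsum_comm]
  refine tsum_congr fun a => ?_
  rw [← ENNReal.tsum_mul_left]
  exact tsum_congr fun b => by rw [mul_assoc]

theorem expect_mono {p : PMF α} {f g : α → ℝ≥0∞} (h : ∀ a ∈ p.support, f a ≤ g a) :
    expect p f ≤ expect p g := by
  refine ENNReal.tsum_le_tsum fun a => ?_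
  by_cases ha : a ∈ p.support
  · exact mul_le_mul_right (h a ha) _
  · rw [PMF.mem_support_iff, not_not] at ha
    simp [ha]

theorem expect_const (p : PMF α) (c : ℝ≥0∞) : expect p (fun _ => c) = c := by
  unfold expect
  rw [ENNReal.tsum_mul_right, p.tsum_coe, one_mul]

theorem expect_le_const {p : PMF α} {f : α → ℝ≥0∞} {c : ℝ≥0∞} (h : ∀ a ∈ p.support, f a ≤ c) :
    expect p f ≤ c :=
  (expect_mono h).trans (expect_const p c).le

theorem expect_add (p : PMF α) (f g : α → ℝ≥0∞) :
    expect p (fun a => f a + g a) = expect p f + expect p g := by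
  unfold expect
  rw [← ENNReal.tsum_add]
  exact tsum_congr fun a => mul_add _ _ _

theorem expect_mul_left (p : PMF α) (c : ℝ≥0∞) (f : α → ℝ≥0∞) :
    expect p (fun a => c * f a) = c * expect p f := by
  unfold expect
  rw [← ENNReal.tsum_mul_left]
  exact tsum_congr fun a => by ring

theorem expect_sum {ι : Type*} (p : PMF α) (s : Finset ι) (f : ι → α → ℝ≥0∞) :
    expect p (fun a => ∑ i ∈ s, f i a) = ∑ i ∈ s, expect p (f i) := by
  classical
  induction s using Finset.induction_on with
  | empty => simpa using expect_const p 0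
  | insert i s hi ih => simp only [Finset.sum_insert hi, expect_add, ih]

theorem toOuterMeasure_eq_expect (p : PMF α) (s : Set α) [DecidablePred (· ∈ s)] :
    p.toOuterMeasure s = expect p fun a => if a ∈ s then 1 else 0 := by
  rw [PMF.toOuterMeasure_apply]
  refine tsum_congr fun a => ?_
  by_cases h : a ∈ s <;> simp [h]

theorem expect_uniformOfFinset (s : Finset α) (hs : s.Nonempty) (f : α → ℝ≥0∞) :
    expect (PMF.uniformOfFinset s hs) f = (s.card : ℝ≥0∞)⁻¹ * ∑ a ∈ s, f a := by
  unfold expect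
  rw [tsum_eq_sum (s := s), Finset.mul_sum]
  · exact Finset.sum_congr rfl fun a ha => by
      rw [PMF.uniformOfFinset_apply_of_mem (hs := hs) ha]
  · intro a ha
    rw [PMF.uniformOfFinset_apply_of_notMem (hs := hs) ha, zero_mul]

theorem expect_uniformOn (s : Finset α) (hs : s.Nonempty) (d : α) (f : α → ℝ≥0∞) :
    expect (uniformOn s d) f = (s.card : ℝ≥0∞)⁻¹ * ∑ a ∈ s, f a := by
  unfold uniformOn
  rw [dif_pos hs, expect_uniformOfFinset]

theorem mem_of_mem_support_uniformOn {s : Finset α} (hs : s.Nonempty) {d a : α}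
    (h : a ∈ (uniformOn s d).support) : a ∈ s := by
  unfold uniformOn at h
  rw [dif_pos hs] at h
  exact (PMF.mem_support_uniformOfFinset_iff hs a).1 h

end Expect

/-! ### Random palettes -/

theorem samplePalette_support {Q : Finset ℕ} (hQ : Q.Nonempty) :
    ∀ (κ : ℕ) (C : Finset ℕ), C ∈ (samplePalette Q κ).support → C ⊆ Q ∧ C.card ≤ κ
  | 0, C, h => by
    simp only [samplePalette, PMF.support_pure, Set.mem_singleton_iff] at h
    simp [h]
  | κ + 1, C, h => by
    simp only [samplePalette, PMF.mem_support_bind_iff, PMF.support_pure,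
      Set.mem_singleton_iff] at h
    obtain ⟨c, hc, D, hD, rfl⟩ := h
    obtain ⟨h1, h2⟩ := samplePalette_support hQ κ D hD
    exact ⟨Finset.insert_subset (mem_of_mem_support_uniformOn hQ hc) h1,
      (Finset.card_insert_le _ _).trans (by omega)⟩

theorem samplePalette_disjoint_le {Q : Finset ℕ} (hQ : Q.Nonempty) (S : Finset ℕ) {ρ : ℝ≥0∞}
    (hρ : (Q.card : ℝ≥0∞)⁻¹ * ((Q \ S).card : ℝ≥0∞) ≤ ρ) :
    ∀ κ : ℕ, expect (samplePalette Q κ) (fun C => if Disjoint S C then 1 else 0) ≤ ρ ^ κ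
  | 0 => by
    rw [samplePalette, expect_pure]
    simp
  | κ + 1 => by
    rw [samplePalette, expect_bind]
    have key : ∀ c, expect ((samplePalette Q κ).bind fun C => PMF.pure (insert c C))
        (fun C => if Disjoint S C then 1 else 0) ≤ (if c ∈ S then 0 else 1) * ρ ^ κ := by
      intro c
      rw [expect_bind]
      simp only [expect_pure]
      by_cases hc : c ∈ S
      · rw [if_pos hc, zero_mul]
        refine expect_le_const fun C _ => ?_
        rw [if_neg]
        exact fun h => Finset.disjoint_left.1 h hc (Finset.mem_insert_self _ _)
      · rw [if_neg hc, one_mul]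
        refine le_trans (expect_mono fun C _ => ?_) (samplePalette_disjoint_le hQ S hρ κ)
        simp [Finset.disjoint_insert_right, hc]
    refine (expect_mono fun c _ => key c).trans ?_
    rw [expect_uniformOn _ hQ, ← Finset.sum_mul, pow_succ', ← mul_assoc]
    refine mul_le_mul_left (le_trans (le_of_eq ?_) hρ) _
    congr 1
    rw [Finset.card_eq_sum_ones, Nat.cast_sum, ← Finset.filter_notMem_eq_sdiff,
      Finset.sum_filter]
    exact Finset.sum_congr rfl fun c _ => by by_cases h : c ∈ S <;> simp [h]

/-! ### Proper partial colorings -/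

section Structure

variable {V : Type*} {G : SimpleGraph V} {φ ψ : Coloring V}

/-- No two distinct edges of `G` that share a vertex have the same colour. -/
def Proper (G : SimpleGraph V) (φ : Coloring V) : Prop :=
  ∀ ⦃x y z : V⦄ ⦃c : ℕ⦄, G.Adj x y → G.Adj x z →
    φ s(x, y) = Status.color c → φ s(x, z) = Status.color c → y = z

/-- The colour `c` appears on no edge at `x`. -/
def Misses (G : SimpleGraph V) (φ : Coloring V) (x : V) (c : ℕ) : Prop :=
  ∀ y, G.Adj x y → φ s(x, y) ≠ Status.color c

theorem exists_getElem?_of_succ {P : List V} {i : ℕ} {v : V} (h : P[i + 1]? = some v) :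
    ∃ u, P[i]? = some u := by
  obtain ⟨hi, -⟩ := List.getElem?_eq_some_iff.1 h
  exact ⟨P[i], List.getElem?_eq_getElem (by omega)⟩

theorem mem_pathEdges {P : List V} {e : Sym2 V} :
    e ∈ pathEdges P ↔ ∃ (i : ℕ) (u w : V), P[i]? = some u ∧ P[i + 1]? = some w ∧ e = s(u, w) := by
  unfold pathEdges
  rw [List.mem_iff_getElem?]
  refine exists_congr fun i => ?_
  rw [List.getElem?_zipWith, List.getElem?_tail]
  rcases h : P[i]? with _ | u <;> rcases h' : P[i + 1]? with _ | w <;> simp [eq_comm]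

/-- The statuses `φ e` and `ψ e` are equal, or both are colours of `C`. -/
def AgreeUpTo (C : Finset ℕ) (φ ψ : Coloring V) (e : Sym2 V) : Prop :=
  ψ e = φ e ∨ ((∃ c ∈ C, φ e = Status.color c) ∧ ∃ c ∈ C, ψ e = Status.color c)

theorem AgreeUpTo.trans {χ : Coloring V} {C : Finset ℕ} {e : Sym2 V} (h : AgreeUpTo C φ ψ e)
    (h' : AgreeUpTo C ψ χ e) : AgreeUpTo C φ χ e := by
  unfold AgreeUpTo at *
  rcases h with h | h <;> rcases h' with h' | h'
  · exact Or.inl (h'.trans h)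
  · exact Or.inr ⟨h ▸ h'.1, h'.2⟩
  · exact Or.inr ⟨h.1, h' ▸ h.2⟩
  · exact Or.inr ⟨h.1, h'.2⟩

theorem AgreeUpTo.blank_iff {C : Finset ℕ} {e : Sym2 V} (h : AgreeUpTo C φ ψ e) :
    ψ e = Status.blank ↔ φ e = Status.blank := by
  rcases h with h | ⟨⟨c, -, h⟩, d, -, h'⟩ <;> simp_all

theorem AgreeUpTo.flg_iff {C : Finset ℕ} {e : Sym2 V} (h : AgreeUpTo C φ ψ e) :
    ψ e = Status.flg ↔ φ e = Status.flg := by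
  rcases h with h | ⟨⟨c, -, h⟩, d, -, h'⟩ <;> simp_all

theorem AgreeUpTo.color_iff {C : Finset ℕ} {e : Sym2 V} (h : AgreeUpTo C φ ψ e) {c : ℕ}
    (hc : c ∉ C) : ψ e = Status.color c ↔ φ e = Status.color c := by
  rcases h with h | ⟨⟨a, ha, h⟩, d, hd, h'⟩
  · rw [h]
  · rw [h, h']
    constructor
    · intro h2
      cases h2
      exact absurd hd hc
    · intro h2
      cases h2
      exact absurd ha hc

/-! ### Alternating walks -/

/-- The colour of the `i`-th edge of an `αβ`-alternating walk. -/
def altColor (α β i : ℕ) : ℕ := if Even i then α else β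

theorem altColor_succ (α β i : ℕ) : altColor α β (i + 1) = altColor β α i := by
  unfold altColor
  by_cases h : Even i <;> simp [h, Nat.even_add_one]

theorem altColor_add_two (α β i : ℕ) : altColor α β (i + 2) = altColor α β i := by
  rw [altColor_succ, altColor_succ]

theorem altColor_congr {α β i j : ℕ} (h : Even i ↔ Even j) :
    altColor α β i = altColor α β j := by
  unfold altColor
  simp [h]

theorem altColor_mem {α β : ℕ} (i : ℕ) : altColor α β i = α ∨ altColor α β i = β := by
  unfold altColor
  split_ifs <;> simp

theorem eq_altColor_or {α β c : ℕ} (h : c = α ∨ c = β) (i : ℕ) :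
    c = altColor α β i ∨ c = altColor α β (i + 1) := by
  rw [altColor_succ]
  unfold altColor
  split_ifs <;> tauto

/-- The vertex sequence `P` starts at `x` and its edges have the colours `α, β, α, …` in `φ`. -/
structure IsAltWalk (G : SimpleGraph V) (φ : Coloring V) (x : V) (α β : ℕ) (P : List V) : Prop where
  head : P[0]? = some x
  step : ∀ ⦃i : ℕ⦄ ⦃u w : V⦄, P[i]? = some u → P[i + 1]? = some w →
    G.Adj u w ∧ φ s(u, w) = Status.color (altColor α β i)

/-- The walk `P` cannot be prolonged by an edge of the next colour. -/
def IsMaximalWalk (G : SimpleGraph V) (φ : Coloring V) (α β : ℕ) (P : List V) : Prop :=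
  ∀ ⦃i : ℕ⦄ ⦃u : V⦄, P[i]? = some u → P[i + 1]? = none → Misses G φ u (altColor α β i)

/-- A vertex is reached at an even position, or at an odd position, by at most one of the
`αβ`-walks that start at a vertex missing `β`, and only once by that walk: the parity determines
the colour by which the vertex is entered, so that the walk can be traced back. -/
theorem IsAltWalk.eq_of_parity (hφ : Proper G φ) {α β : ℕ} {x x' v : V} {P P' : List V}
    (hP : IsAltWalk G φ x α β P) (hP' : IsAltWalk G φ x' α β P')
    (hx : Misses G φ x β) (hx' : Misses G φ x' β) :
    ∀ {i i' : ℕ}, P[i]? = some v → P'[i']? = some v → (Even i ↔ Even i') → x = x' ∧ i = i' := by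
  intro i
  induction i generalizing v with
  | zero =>
    intro i' h h' hpar
    rw [hP.head, Option.some_inj] at h
    subst h
    cases i' with
    | zero =>
      rw [hP'.head, Option.some_inj] at h'
      exact ⟨h'.symm, rfl⟩
    | succ k =>
      exfalso
      obtain ⟨u, hu⟩ := exists_getElem?_of_succ h'
      obtain ⟨h1, h2⟩ := hP'.step hu h'
      have hk : ¬ Even k := by
        have := hpar.1 Even.zero
        rwa [Nat.even_add_one] at this
      rw [altColor, if_neg hk, Sym2.eq_swap] at h2
      exact hx u h1.symm h2
  | succ i ih =>
    intro i' h h' hpar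
    obtain ⟨u, hu⟩ := exists_getElem?_of_succ h
    obtain ⟨h1, h2⟩ := hP.step hu h
    cases i' with
    | zero =>
      exfalso
      rw [hP'.head, Option.some_inj] at h'
      subst h'
      have hk : ¬ Even i := by
        have := hpar.2 Even.zero
        rwa [Nat.even_add_one] at this
      rw [altColor, if_neg hk, Sym2.eq_swap] at h2
      exact hx' u h1.symm h2
    | succ k =>
      obtain ⟨u', hu'⟩ := exists_getElem?_of_succ h'
      obtain ⟨h1', h2'⟩ := hP'.step hu' h'
      have hpar' : Even i ↔ Even k := by
        rw [Nat.even_add_one, Nat.even_add_one] at hpar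
        tauto
      rw [← altColor_congr hpar', Sym2.eq_swap] at h2'
      rw [Sym2.eq_swap] at h2
      have := hφ h1.symm h1'.symm h2 h2'
      subst this
      obtain ⟨h3, h4⟩ := ih hu hu' hpar'
      exact ⟨h3, by rw [h4]⟩

/-- A walk does not visit a vertex at two positions of different parity: otherwise it would have
to turn around in the middle. -/
theorem IsAltWalk.ne_of_odd_sub (hφ : Proper G φ) {α β : ℕ} {x : V} {P : List V}
    (hP : IsAltWalk G φ x α β P) (k : ℕ) :
    ∀ {i : ℕ} {v : V}, P[i]? = some v → P[i + (2 * k + 1)]? ≠ some v := by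
  induction k with
  | zero =>
    intro i v h h'
    exact (hP.step h h').1.ne rfl
  | succ k ih =>
    intro i v h h'
    have hlen := (List.getElem?_eq_some_iff.1 h').1
    obtain ⟨u, hu⟩ : ∃ u, P[i + 1]? = some u :=
      ⟨_, List.getElem?_eq_getElem (by omega)⟩
    have e1 : i + (2 * (k + 1) + 1) = i + 1 + (2 * k + 1) + 1 := by ring
    rw [e1] at h'
    obtain ⟨u', hu'⟩ := exists_getElem?_of_succ h'
    obtain ⟨h1, h2⟩ := hP.step h hu
    obtain ⟨h3, h4⟩ := hP.step hu' h'
    have hc : altColor α β (i + 1 + (2 * k + 1)) = altColor α β i :=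
      altColor_congr (by grind)
    rw [hc, Sym2.eq_swap] at h4
    have := hφ h1 h3.symm h2 h4
    subst this
    exact ih hu hu'

theorem IsAltWalk.injective (hφ : Proper G φ) {α β : ℕ} {x : V} {P : List V}
    (hP : IsAltWalk G φ x α β P) (hx : Misses G φ x β) {i j : ℕ} {v : V}
    (hi : P[i]? = some v) (hj : P[j]? = some v) : i = j := by
  by_cases hpar : Even i ↔ Even j
  · exact (hP.eq_of_parity hφ hP hx hx hi hj hpar).2
  · exfalso
    rcases le_total i j with h | h
    · obtain ⟨k, hk⟩ : ∃ k, j = i + (2 * k + 1) := ⟨(j - i) / 2, by grind⟩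
      exact hP.ne_of_odd_sub hφ k hi (hk ▸ hj)
    · obtain ⟨k, hk⟩ : ∃ k, i = j + (2 * k + 1) := ⟨(i - j) / 2, by grind⟩
      exact hP.ne_of_odd_sub hφ k hj (hk ▸ hi)

/-- A vertex of a maximal walk is incident to edges of the colours `α` and `β` only on the walk. -/
theorem IsAltWalk.mem_pathEdges_of_color (hφ : Proper G φ) {α β : ℕ} {x : V} {P : List V}
    (hP : IsAltWalk G φ x α β P) (hmax : IsMaximalWalk G φ α β P) (hx : Misses G φ x β)
    {u w : V} (hu : u ∈ P) (huw : G.Adj u w) {c : ℕ} (hc : c = α ∨ c = β)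
    (hcol : φ s(u, w) = Status.color c) : s(u, w) ∈ pathEdges P := by
  obtain ⟨i, hi⟩ := List.mem_iff_getElem?.1 hu
  rcases eq_altColor_or hc i with h | h
  · subst h
    rcases h' : P[i + 1]? with _ | z
    · exact absurd hcol (hmax hi h' w huw)
    · obtain ⟨h1, h2⟩ := hP.step hi h'
      have := hφ huw h1 hcol h2
      subst this
      exact mem_pathEdges.2 ⟨i, u, w, hi, h', rfl⟩
  · subst h
    cases i with
    | zero =>
      rw [hP.head, Option.some_inj] at hi
      subst hi
      exact absurd hcol (by simpa [altColor] using hx w huw)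
    | succ k =>
      obtain ⟨z, hz⟩ := exists_getElem?_of_succ hi
      obtain ⟨h1, h2⟩ := hP.step hz hi
      rw [altColor_add_two] at hcol
      rw [Sym2.eq_swap] at h2
      have := hφ huw h1.symm hcol h2
      subst this
      exact mem_pathEdges.2 ⟨k, w, u, hz, hi, Sym2.eq_swap⟩

/-- A vertex of the walk that misses `α` and is not its start is its end. -/
theorem IsAltWalk.getLast?_of_misses {α β : ℕ} {x : V} {P : List V}
    (hP : IsAltWalk G φ x α β P) {u : V} (hu : Misses G φ u α) (hux : u ≠ x) {i : ℕ}
    (hi : P[i]? = some u) : P[i + 1]? = none := by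
  cases i with
  | zero =>
    rw [hP.head, Option.some_inj] at hi
    exact absurd hi.symm hux
  | succ k =>
    rcases h' : P[k + 1 + 1]? with _ | z
    · rfl
    · exfalso
      obtain ⟨y, hy⟩ := exists_getElem?_of_succ hi
      obtain ⟨h1, h2⟩ := hP.step hy hi
      obtain ⟨h3, h4⟩ := hP.step hi h'
      by_cases hk : Even k
      · rw [altColor, if_pos hk, Sym2.eq_swap] at h2
        exact hu y h1.symm h2
      · rw [altColor, if_pos (Nat.even_add_one.2 hk)] at h4
        exact hu z h3 h4

variable [DecidableEq V]

/-- Removing the colour of an edge, or flagging it, keeps a coloring proper. -/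
theorem Proper.update (hφ : Proper G φ) (e : Sym2 V) {s : Status}
    (hs : ∀ c, s ≠ Status.color c) : Proper G (Function.update φ e s) := by
  have key : ∀ f c, Function.update φ e s f = Status.color c → φ f = Status.color c := by
    intro f c hf
    by_cases h : f = e
    · subst h
      simp [hs c] at hf
    · rwa [Function.update_of_ne h] at hf
  exact fun x y z c h1 h2 h3 h4 => hφ h1 h2 (key _ _ h3) (key _ _ h4)

theorem Misses.update {x : V} {c : ℕ} (h : Misses G φ x c) (e : Sym2 V) {s : Status}
    (hs : s ≠ Status.color c) : Misses G (Function.update φ e s) x c := by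
  intro y hy
  by_cases h1 : s(x, y) = e
  · subst h1
    simpa using hs
  · rw [Function.update_of_ne h1]
    exact h y hy

/-! ### Flipping an alternating path -/

theorem flipPath_apply_of_mem {P : List V} {α β : ℕ} {e : Sym2 V} (he : e ∈ pathEdges P) :
    flipPath φ P α β e = Equiv.swap (Status.color α) (Status.color β) (φ e) := by
  simp only [flipPath, if_pos he, Equiv.swap_apply_def]

theorem flipPath_apply_of_notMem {P : List V} {α β : ℕ} {e : Sym2 V} (he : e ∉ pathEdges P) :
    flipPath φ P α β e = φ e := by
  simp only [flipPath, if_neg he]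

theorem flipPath_singleton (x : V) (α β : ℕ) : flipPath φ [x] α β = φ := by
  funext e
  exact flipPath_apply_of_notMem (by simp [pathEdges])

theorem flipPath_color_iff {P : List V} {α β c : ℕ} (hα : c ≠ α) (hβ : c ≠ β) (e : Sym2 V) :
    flipPath φ P α β e = Status.color c ↔ φ e = Status.color c := by
  by_cases he : e ∈ pathEdges P
  · rw [flipPath_apply_of_mem he, Equiv.swap_apply_eq_iff, Equiv.swap_apply_of_ne_of_ne]
    · simpa using hα
    · simpa using hβ
  · rw [flipPath_apply_of_notMem he]

theorem flipPath_agreeUpTo {C : Finset ℕ} {α β : ℕ} (hα : α ∈ C) (hβ : β ∈ C) (P : List V)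
    (e : Sym2 V) : AgreeUpTo C φ (flipPath φ P α β) e := by
  by_cases he : e ∈ pathEdges P
  · rw [AgreeUpTo, flipPath_apply_of_mem he]
    by_cases h1 : φ e = Status.color α
    · exact Or.inr ⟨⟨α, hα, h1⟩, β, hβ, by rw [h1, Equiv.swap_apply_left]⟩
    · by_cases h2 : φ e = Status.color β
      · exact Or.inr ⟨⟨β, hβ, h2⟩, α, hα, by rw [h2, Equiv.swap_apply_right]⟩
      · exact Or.inl (Equiv.swap_apply_of_ne_of_ne h1 h2)
  · exact Or.inl (flipPath_apply_of_notMem he)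

section Flip

variable {α β : ℕ} {x : V} {P : List V}

theorem flipPath_at_of_notMem {u w : V} (hu : u ∉ P) :
    flipPath φ P α β s(u, w) = φ s(u, w) := by
  refine flipPath_apply_of_notMem fun h => ?_
  obtain ⟨i, a, b, ha, hb, he⟩ := mem_pathEdges.1 h
  have : u = a ∨ u = b := by
    have : u ∈ s(a, b) := he ▸ Sym2.mem_mk_left u w
    simpa using this
  rcases this with rfl | rfl
  · exact hu (List.mem_of_getElem? ha)
  · exact hu (List.mem_of_getElem? hb)

theorem flipPath_at_of_mem (hφ : Proper G φ) (hP : IsAltWalk G φ x α β P)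
    (hmax : IsMaximalWalk G φ α β P) (hx : Misses G φ x β) {u w : V} (hu : u ∈ P)
    (huw : G.Adj u w) :
    flipPath φ P α β s(u, w) = Equiv.swap (Status.color α) (Status.color β) (φ s(u, w)) := by
  by_cases he : s(u, w) ∈ pathEdges P
  · exact flipPath_apply_of_mem he
  · rw [flipPath_apply_of_notMem he, Equiv.swap_apply_of_ne_of_ne]
    · exact fun h => he (hP.mem_pathEdges_of_color hφ hmax hx hu huw (Or.inl rfl) h)
    · exact fun h => he (hP.mem_pathEdges_of_color hφ hmax hx hu huw (Or.inr rfl) h)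

theorem Proper.flipPath (hφ : Proper G φ) (hP : IsAltWalk G φ x α β P)
    (hmax : IsMaximalWalk G φ α β P) (hx : Misses G φ x β) :
    Proper G (flipPath φ P α β) := by
  intro u y z c hy hz hcy hcz
  by_cases hu : u ∈ P
  · rw [flipPath_at_of_mem hφ hP hmax hx hu hy] at hcy
    rw [flipPath_at_of_mem hφ hP hmax hx hu hz] at hcz
    have heq : φ s(u, y) = φ s(u, z) := (Equiv.injective _) (hcy.trans hcz.symm)
    rcases hst : φ s(u, y) with _ | _ | d
    · simp [hst, Equiv.swap_apply_def] at hcy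
    · simp [hst, Equiv.swap_apply_def] at hcy
    · exact hφ hy hz hst (heq ▸ hst)
  · rw [flipPath_at_of_notMem hu] at hcy hcz
    exact hφ hy hz hcy hcz

theorem Misses.flipPath_of_notMem {u : V} {c : ℕ} (h : Misses G φ u c) (hu : u ∉ P) :
    Misses G (flipPath φ P α β) u c := by
  intro y hy
  rw [flipPath_at_of_notMem hu]
  exact h y hy

theorem Misses.flipPath_of_mem (hφ : Proper G φ) (hP : IsAltWalk G φ x α β P)
    (hmax : IsMaximalWalk G φ α β P) (hx : Misses G φ x β) {u : V} {c d : ℕ} (hu : u ∈ P)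
    (h : Misses G φ u c)
    (hcd : Equiv.swap (Status.color α) (Status.color β) (Status.color d) = Status.color c) :
    Misses G (EdgeColoring.flipPath φ P α β) u d := by
  intro y hy
  rw [flipPath_at_of_mem hφ hP hmax hx hu hy, Ne, Equiv.swap_apply_eq_iff, hcd]
  exact h y hy

theorem Misses.flipPath_of_ne {u : V} {c : ℕ} (h : Misses G φ u c) (hα : c ≠ α) (hβ : c ≠ β) :
    Misses G (flipPath φ P α β) u c := by
  intro y hy
  rw [Ne, flipPath_color_iff hα hβ]
  exact h y hy

end Flip

end Structure

/-! ### Fans and shifts -/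

section Fans

variable {V : Type*} {G : SimpleGraph V} {φ ψ : Coloring V}

/-- The relation between consecutive vertices `a`, `b` of a fan with pivot `x`: the edge `xb` has a
colour of `C` that is missing at `a`. -/
def FanStep (G : SimpleGraph V) (φ : Coloring V) (x : V) (C : Finset ℕ) (a b : V) : Prop :=
  ∃ c ∈ C, Misses G φ a c ∧ φ s(x, b) = Status.color c

/-- The list `ys` of neighbours of `x` is a fan of `φ` with pivot `x` and first vertex `y`, all of
whose colours are in `C`. -/
structure IsFan (G : SimpleGraph V) (φ : Coloring V) (x y : V) (C : Finset ℕ) (ys : List V) :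
    Prop where
  head : ys.head? = some y
  nodup : ys.Nodup
  adj : ∀ z ∈ ys, G.Adj x z
  chain : ys.IsChain (FanStep G φ x C)

variable [DecidableEq V]

theorem shiftAndColor_singleton (x y : V) (α : ℕ) :
    shiftAndColor φ x [y] α = Function.update φ s(x, y) (Status.color α) := by
  simp [shiftAndColor, shiftFan]

theorem shiftAndColor_cons_cons (x y z : V) (ys : List V) (α : ℕ) :
    shiftAndColor φ x (y :: z :: ys) α =
      shiftAndColor (Function.update φ s(x, y) (φ s(x, z))) x (z :: ys) α := by
  simp only [shiftAndColor, shiftFan, List.getLast?_cons_cons]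
  rw [List.getLast?_eq_some_getLast (List.cons_ne_nil z ys)]

theorem shiftAndColor_apply_of_notMem {x : V} {α : ℕ} {e : Sym2 V} :
    ∀ {ys : List V} {φ : Coloring V}, (∀ y ∈ ys, e ≠ s(x, y)) → shiftAndColor φ x ys α e = φ e
  | [], φ, _ => by simp [shiftAndColor]
  | [y], φ, h => by
    rw [shiftAndColor_singleton, Function.update_of_ne (h y (by simp))]
  | y :: z :: ys, φ, h => by
    rw [shiftAndColor_cons_cons,
      shiftAndColor_apply_of_notMem fun w hw => h w (List.mem_cons_of_mem _ hw),
      Function.update_of_ne (h y (by simp))]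

theorem shiftAndColor_apply_of_mem {x : V} {α : ℕ} {C : Finset ℕ} (hα : α ∈ C) {w : V} :
    ∀ {ys : List V} {y : V} {φ : Coloring V}, (y :: ys).Nodup →
      (y :: ys).IsChain (fun _ b => ∃ c ∈ C, φ s(x, b) = Status.color c) → w ∈ y :: ys →
      ∃ c ∈ C, shiftAndColor φ x (y :: ys) α s(x, w) = Status.color c
  | [], y, φ, _, _, hw => by
    rw [List.mem_singleton] at hw
    subst hw
    exact ⟨α, hα, by rw [shiftAndColor_singleton, Function.update_self]⟩
  | z :: ys, y, φ, hnd, hch, hw => by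
    rw [shiftAndColor_cons_cons]
    have hnd' := List.nodup_cons.1 hnd
    obtain ⟨hyz, hch'⟩ := List.isChain_cons_cons.1 hch
    rcases List.mem_cons.1 hw with rfl | hw
    · obtain ⟨c, hc, hcol⟩ := hyz
      refine ⟨c, hc, ?_⟩
      rw [shiftAndColor_apply_of_notMem, Function.update_self, hcol]
      intro b hb e
      rw [Sym2.congr_right] at e
      exact hnd'.1 (e ▸ hb)
    · refine shiftAndColor_apply_of_mem hα hnd'.2 (hch'.imp_of_mem_imp ?_) hw
      rintro a b - hb ⟨c, hc, hcol⟩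
      refine ⟨c, hc, ?_⟩
      rw [Function.update_of_ne, hcol]
      intro e
      rw [Sym2.congr_right] at e
      exact hnd'.1 (e ▸ hb)

/-- Shifting a fan and colouring its last edge with `α` keeps the coloring proper if `α` is missing
at the pivot and at the last vertex. During the shift, properness is required only of the coloring
in which the first edge of the remaining fan is disregarded. -/
theorem proper_shiftAndColor {x : V} {α : ℕ} {C : Finset ℕ} :
    ∀ {ys : List V} {y : V} {φ : Coloring V}, (y :: ys).Nodup → (∀ z ∈ y :: ys, G.Adj x z) →
      (y :: ys).IsChain (FanStep G φ x C) → Misses G φ x α →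
      (∀ l, (y :: ys).getLast? = some l → Misses G φ l α) →
      Proper G (Function.update φ s(x, y) Status.blank) →
      Proper G (shiftAndColor φ x (y :: ys) α)
  | [], y, φ, _, hadj, _, hx, hl, hprop => by
    rw [shiftAndColor_singleton]
    have hy := hl y rfl
    have key : ∀ {u a b : V}, G.Adj u a → G.Adj u b → s(u, a) = s(x, y) → s(u, b) ≠ s(x, y) →
        φ s(u, b) ≠ Status.color α := by
      intro u a b hua hub he hne hcol
      rcases Sym2.eq_iff.1 he with ⟨rfl, rfl⟩ | ⟨rfl, rfl⟩
      · exact hx b hub hcol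
      · exact hy b hub hcol
    intro u a b c ha hb hca hcb
    by_cases h1 : s(u, a) = s(x, y) <;> by_cases h2 : s(u, b) = s(x, y)
    · exact Sym2.congr_right.1 (h1.trans h2.symm)
    · rw [h1, Function.update_self] at hca
      rw [Function.update_of_ne h2] at hcb
      cases hca
      exact absurd hcb (key ha hb h1 h2)
    · rw [h2, Function.update_self] at hcb
      rw [Function.update_of_ne h1] at hca
      cases hcb
      exact absurd hca (key hb ha h2 h1)
    · refine hprop (c := c) ha hb ?_ ?_
      · rwa [Function.update_of_ne h1] at hca ⊢
      · rwa [Function.update_of_ne h2] at hcb ⊢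
  | z :: ys, y, φ, hnd, hadj, hch, hx, hl, hprop => by
    rw [shiftAndColor_cons_cons]
    have hnd' := List.nodup_cons.1 hnd
    have hyz : z ≠ y := fun e => hnd'.1 (by simp [e])
    have hxy := hadj y (by simp)
    have hxz := hadj z (by simp)
    obtain ⟨⟨c₀, hc₀, hmiss, hcol⟩, hch'⟩ := List.isChain_cons_cons.1 hch
    have hne : s(x, z) ≠ s(x, y) := fun e => hyz (Sym2.congr_right.1 e)
    have hupd : ∀ {a : V}, a ≠ x → a ≠ y → ∀ {w : V} (s : Status),
        Function.update φ s(x, y) s s(a, w) = φ s(a, w) := by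
      intro a hax hay w s
      refine Function.update_of_ne (fun e => ?_) _ _
      rcases Sym2.eq_iff.1 e with ⟨e1, -⟩ | ⟨e1, -⟩
      · exact hax e1
      · exact hay e1
    refine proper_shiftAndColor (C := C) hnd'.2 (fun w hw => hadj w (List.mem_cons_of_mem _ hw))
      (hch'.imp_of_mem_imp ?_) ?_ ?_ ?_
    · rintro a b ha hb ⟨c, hc, hm, hcb⟩
      refine ⟨c, hc, fun w hw => ?_, ?_⟩
      · rw [hupd (hadj a (List.mem_cons_of_mem _ ha)).ne' (fun e => hnd'.1 (e ▸ ha))]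
        exact hm w hw
      · rw [Function.update_of_ne, hcb]
        intro e
        exact hnd'.1 (Sym2.congr_right.1 e ▸ hb)
    · exact hx.update _ (hx z hxz)
    · intro l hlast
      have hmem : l ∈ z :: ys := List.mem_of_getLast? hlast
      intro w hw
      rw [hupd (hadj l (List.mem_cons_of_mem _ hmem)).ne' (fun e => hnd'.1 (e ▸ hmem))]
      exact hl l (by rw [List.getLast?_cons_cons]; exact hlast) w hw
    · -- the colour `c₀` is missing at `y`, and at `x` it appeared on `xz` only
      rw [hcol]
      have key : ∀ {u a b : V}, G.Adj u a → G.Adj u b → s(u, a) = s(x, y) → s(u, b) ≠ s(x, y) →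
          s(u, b) ≠ s(x, z) → φ s(u, b) ≠ Status.color c₀ := by
        intro u a b hua hub he hne1 hne2 hcol'
        rcases Sym2.eq_iff.1 he with ⟨rfl, rfl⟩ | ⟨rfl, rfl⟩
        · have := hprop (c := c₀) hub hxz
            (by rw [Function.update_of_ne hne1, hcol']) (by rw [Function.update_of_ne hne, hcol])
          exact hne2 (by rw [this])
        · exact hmiss b hub hcol'
      intro u a b c ha hb hca hcb
      have hza : s(u, a) ≠ s(x, z) := by
        intro e
        rw [e, Function.update_self] at hca
        cases hca
      have hzb : s(u, b) ≠ s(x, z) := by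
        intro e
        rw [e, Function.update_self] at hcb
        cases hcb
      rw [Function.update_of_ne hza] at hca
      rw [Function.update_of_ne hzb] at hcb
      by_cases h1 : s(u, a) = s(x, y) <;> by_cases h2 : s(u, b) = s(x, y)
      · exact Sym2.congr_right.1 (h1.trans h2.symm)
      · rw [h1, Function.update_self] at hca
        rw [Function.update_of_ne h2] at hcb
        cases hca
        exact absurd hcb (key ha hb h1 h2 hzb)
      · rw [h2, Function.update_self] at hcb
        rw [Function.update_of_ne h1] at hca
        cases hcb
        exact absurd hca (key hb ha h2 h1 hza)
      · refine hprop (c := c) ha hb ?_ ?_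
        · rwa [Function.update_of_ne h1] at hca ⊢
        · rwa [Function.update_of_ne h2] at hcb ⊢

/-- The effect of shifting a fan of a proper coloring whose first edge is blank. -/
theorem IsFan.shiftAndColor {x y : V} {α : ℕ} {C : Finset ℕ} {ys : List V} (hφ : Proper G φ)
    (hf : IsFan G φ x y C ys) (hα : α ∈ C) (hx : Misses G φ x α)
    (hl : ∀ l, ys.getLast? = some l → Misses G φ l α) :
    Proper G (shiftAndColor φ x ys α) ∧
      (∀ e, e ≠ s(x, y) → AgreeUpTo C φ (shiftAndColor φ x ys α) e) ∧
      ∃ c ∈ C, EdgeColoring.shiftAndColor φ x ys α s(x, y) = Status.color c := by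
  obtain ⟨hhead, hnd, hadj, hch⟩ := hf
  cases ys with
  | nil => simp at hhead
  | cons z zs =>
    rw [List.head?_cons, Option.some_inj] at hhead
    subst hhead
    have hch' : (z :: zs).IsChain (fun _ b => ∃ c ∈ C, φ s(x, b) = Status.color c) :=
      hch.imp fun a b ⟨c, hc, _, h⟩ => ⟨c, hc, h⟩
    refine ⟨proper_shiftAndColor hnd hadj hch hx hl (hφ.update _ (by simp)), fun e he => ?_,
      shiftAndColor_apply_of_mem hα hnd hch' (by simp)⟩
    by_cases hmem : ∃ w ∈ z :: zs, e = s(x, w)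
    · obtain ⟨w, hw, rfl⟩ := hmem
      refine Or.inr ⟨?_, shiftAndColor_apply_of_mem hα hnd hch' hw⟩
      have hwz : w ≠ z := fun h => he (by rw [h])
      obtain ⟨i, hi⟩ := List.mem_iff_getElem?.1 hw
      cases i with
      | zero => exact absurd (by simpa using hi.symm) hwz
      | succ i =>
        obtain ⟨hlt, hget⟩ := List.getElem?_eq_some_iff.1 hi
        have := (List.isChain_iff_getElem.1 hch') i hlt
        rwa [hget] at this
    · push Not at hmem
      exact Or.inl (shiftAndColor_apply_of_notMem hmem)

end Fans

/-! ### The Vizing chains found by the algorithm -/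

section Chains

variable {V : Type*} [Fintype V] {G : SimpleGraph V} [DecidableRel G.Adj] {q : ℕ}
  {φ ψ : Coloring V}

theorem mem_missing {x : V} {c : ℕ} :
    c ∈ missing G q φ x ↔ c ∈ Finset.Icc 1 q ∧ Misses G φ x c := by
  simp [missing, Misses]

theorem card_sdiff_missing_le {Q : Finset ℕ} (hQ : Q ⊆ Finset.Icc 1 q) (z : V) :
    (Q \ missing G q φ z).card ≤ G.maxDegree := by
  refine le_trans ?_ (G.degree_le_maxDegree z)
  rw [← SimpleGraph.card_neighborFinset_eq_degree]
  refine (Finset.card_le_card (t := (G.neighborFinset z).image fun y =>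
    match φ s(z, y) with
    | Status.color c => c
    | _ => 0) fun c hc => ?_).trans Finset.card_image_le
  rw [Finset.mem_sdiff, mem_missing, not_and] at hc
  have := hc.2 (hQ hc.1)
  simp only [Misses, not_forall, not_not] at this
  obtain ⟨y, hy, hcol⟩ := this
  exact Finset.mem_image.2 ⟨y, by simpa using hy, by simp only [hcol]⟩

theorem nbrAt_eq_some {x y : V} {c : ℕ} (h : nbrAt G φ x c = some y) :
    G.Adj x y ∧ φ s(x, y) = Status.color c := by
  unfold nbrAt at h
  split_ifs at h with h'
  rw [Option.some_inj] at h
  exact h ▸ h'.choose_spec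

theorem nbrAt_eq_none {x : V} {c : ℕ} (h : nbrAt G φ x c = none) : Misses G φ x c := by
  unfold nbrAt at h
  split_ifs at h with h'
  exact fun y hy hc => h' ⟨y, hy, hc⟩

theorem altPath_getElem?_zero (x : V) (c c' s : ℕ) : (altPath G φ x c c' s)[0]? = some x := by
  cases s with
  | zero => rfl
  | succ s =>
    rw [altPath]
    split <;> rfl

theorem altPath_of_nbrAt {x w : V} {c : ℕ} (h : nbrAt G φ x c = some w) (c' s : ℕ) :
    altPath G φ x c c' (s + 1) = x :: altPath G φ w c' c s := by
  rw [altPath, h]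

theorem isAltWalk_altPath (x : V) (c c' s : ℕ) :
    IsAltWalk G φ x c c' (altPath G φ x c c' s) := by
  refine ⟨altPath_getElem?_zero x c c' s, ?_⟩
  induction s generalizing x c c' with
  | zero =>
    intro i u w _ hw
    simp [altPath] at hw
  | succ s ih =>
    intro i u w hu hw
    rcases hz : nbrAt G φ x c with _ | z
    · simp [altPath, hz] at hw
    · rw [altPath_of_nbrAt hz] at hu hw
      cases i with
      | zero =>
        simp only [List.getElem?_cons_zero, Option.some_inj] at hu
        rw [List.getElem?_cons_succ, altPath_getElem?_zero, Option.some_inj] at hw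
        subst hu hw
        simpa [altColor] using nbrAt_eq_some hz
      | succ i =>
        rw [List.getElem?_cons_succ] at hu hw
        rw [altColor_succ]
        exact ih z c' c hu hw

theorem isMaximalWalk_altPath {x : V} {c c' s : ℕ}
    (h : (altPath G φ x c c' s).length ≤ s) :
    IsMaximalWalk G φ c c' (altPath G φ x c c' s) := by
  induction s generalizing x c c' with
  | zero => simp [altPath] at h
  | succ s ih =>
    intro i u hu hn
    rcases hz : nbrAt G φ x c with _ | z
    · cases i with
      | zero =>
        rw [altPath_getElem?_zero, Option.some_inj] at hu
        subst hu
        simpa [altColor] using nbrAt_eq_none hz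
      | succ i => simp [altPath, hz] at hu
    · rw [altPath_of_nbrAt hz] at hu hn h
      cases i with
      | zero =>
        rw [List.getElem?_cons_succ, altPath_getElem?_zero] at hn
        cases hn
      | succ i =>
        rw [List.getElem?_cons_succ] at hu hn
        rw [altColor_succ]
        exact ih (by simpa using h) hu hn

variable [DecidableEq V]

theorem makeFanLoop_spec {x y : V} {C : Finset ℕ} (ys : List V) (z : V) {ys' : List V}
    {η j : ℕ} (hfan : IsFan G φ x y C ys) (hlast : ys.getLast? = some z)
    (h : makeFanLoop G q φ x C ys z = some (ys', η, j)) :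
    IsFan G φ x y C ys' ∧ η ∈ C ∧ (∀ l, ys'.getLast? = some l → Misses G φ l η) ∧
      ((nbrAt G φ x η = none ∧ j = ys'.length) ∨
        ∃ w ∈ ys', nbrAt G φ x η = some w ∧ j = ys'.idxOf w) := by
  induction ys, z using makeFanLoop.induct G q φ x C with
  | case1 ys z hne η' hnone =>
    rw [makeFanLoop, dif_pos hne] at h
    simp only [η'] at hnone
    simp only [hnone, Option.some_inj, Prod.mk.injEq] at h
    obtain ⟨rfl, rfl, rfl⟩ := h
    have hm := Finset.mem_inter.1 (Finset.min'_mem _ hne)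
    refine ⟨hfan, hm.2, fun l hl => ?_, Or.inl ⟨hnone, rfl⟩⟩
    rw [hlast, Option.some_inj] at hl
    exact hl ▸ (mem_missing.1 hm.1).2
  | case2 ys z hne η' w hsome hw =>
    rw [makeFanLoop, dif_pos hne] at h
    simp only [η'] at hsome
    simp only [hsome, if_pos hw, Option.some_inj, Prod.mk.injEq] at h
    obtain ⟨rfl, rfl, rfl⟩ := h
    have hm := Finset.mem_inter.1 (Finset.min'_mem _ hne)
    refine ⟨hfan, hm.2, fun l hl => ?_, Or.inr ⟨w, hw, hsome, rfl⟩⟩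
    rw [hlast, Option.some_inj] at hl
    exact hl ▸ (mem_missing.1 hm.1).2
  | case3 ys z hne η' w hsome hw ih =>
    rw [makeFanLoop, dif_pos hne] at h
    simp only [η'] at hsome
    simp only [hsome, if_neg hw] at h
    have hm := Finset.mem_inter.1 (Finset.min'_mem _ hne)
    obtain ⟨h1, h2⟩ := nbrAt_eq_some hsome
    refine ih ⟨?_, ?_, ?_, ?_⟩ (by simp) h
    · rw [List.head?_append, hfan.head]
      rfl
    · rw [List.nodup_append]
      refine ⟨hfan.nodup, by simp, fun a ha b hb => ?_⟩
      rw [List.mem_singleton] at hb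
      rintro rfl
      exact hw (hb ▸ ha)
    · intro a ha
      rcases List.mem_append.1 ha with ha | ha
      · exact hfan.adj a ha
      · rw [List.mem_singleton] at ha
        exact ha ▸ h1
    · refine List.isChain_append.2 ⟨hfan.chain, by simp, fun a ha b hb => ?_⟩
      rw [Option.mem_def, hlast, Option.some_inj] at ha
      simp only [List.head?_cons, Option.mem_def, Option.some_inj] at hb
      subst ha hb
      exact ⟨_, hm.2, (mem_missing.1 hm.1).2, h2⟩
  | case4 ys z hne =>
    rw [makeFanLoop, dif_neg hne] at h
    cases h

/-- If the fan construction fails, then the palette misses `M(φ, z)` for the first vertex `z = y`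
of the fan or for a neighbour `z` of the pivot. -/
theorem makeFanLoop_eq_none {x y : V} {C : Finset ℕ} (ys : List V) (z : V)
    (hz : z = y ∨ G.Adj x z) (h : makeFanLoop G q φ x C ys z = none) :
    ∃ u, (u = y ∨ G.Adj x u) ∧ Disjoint (missing G q φ u) C := by
  induction ys, z using makeFanLoop.induct G q φ x C with
  | case1 ys z hne η' hnone =>
    rw [makeFanLoop, dif_pos hne] at h
    simp only [η'] at hnone
    simp [hnone] at h
  | case2 ys z hne η' w hsome hw =>
    rw [makeFanLoop, dif_pos hne] at h
    simp only [η'] at hsome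
    simp [hsome, hw] at h
  | case3 ys z hne η' w hsome hw ih =>
    rw [makeFanLoop, dif_pos hne] at h
    simp only [η'] at hsome
    simp only [hsome, if_neg hw] at h
    exact ih (Or.inr (nbrAt_eq_some hsome).1) h
  | case4 ys z hne =>
    exact ⟨z, hz, Finset.disjoint_iff_inter_eq_empty.2 (Finset.not_nonempty_iff_eq_empty.1 hne)⟩

/-- What is known about a Vizing chain `K` produced for the uncolored edge `xy` with pivot `x` and
palette `C`: its path is either trivial or a longest alternating path with at most `ℓ` edges. -/
structure IsVizingChain (G : SimpleGraph V) [DecidableRel G.Adj] (φ : Coloring V) (x y : V)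
    (C : Finset ℕ) (ℓ : ℕ) (K : VizingChain V) : Prop where
  fan : IsFan G φ x y C K.ys
  α_mem : K.α ∈ C
  last : ∀ l, K.ys.getLast? = some l → Misses G φ l K.α
  path : (K.path = [x] ∧ Misses G φ x K.α) ∨
    (K.β ∈ C ∧ Misses G φ x K.β ∧ ∃ w ∈ K.ys, nbrAt G φ x K.α = some w ∧
      K.path = altPath G φ x K.α K.β ℓ)

theorem isVizingChain_of_eq_some {x y : V} (hxy : G.Adj x y) {C : Finset ℕ} {ℓ : ℕ}
    {K : VizingChain V} (h : vizingChain G q φ x y C ℓ = some K) :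
    IsVizingChain G φ x y C ℓ K := by
  unfold vizingChain at h
  rcases hf : makeFan G q φ x y C with _ | ⟨ys, α, j⟩
  · simp [hf] at h
  · have hfan : IsFan G φ x y C [y] := ⟨rfl, by simp, by simpa using hxy, by simp⟩
    obtain ⟨h1, h2, h3, h4⟩ := makeFanLoop_spec [y] y hfan rfl hf
    simp only [hf] at h
    split_ifs at h with hj hne
    · rw [Option.some_inj] at h
      subst h
      refine ⟨h1, h2, h3, Or.inl ⟨rfl, ?_⟩⟩
      rcases h4 with h4 | ⟨w, hw, -, h5⟩
      · exact nbrAt_eq_none h4.1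
      · have := List.idxOf_lt_length_iff.2 hw
        omega
    · rw [Option.some_inj] at h
      subst h
      have hm := Finset.mem_inter.1 (Finset.min'_mem _ hne)
      refine ⟨h1, h2, h3, Or.inr ⟨hm.2, (mem_missing.1 hm.1).2, ?_⟩⟩
      rcases h4 with h4 | ⟨w, hw, h5, -⟩
      · exact absurd h4.2 hj
      · exact ⟨w, hw, h5, rfl⟩

theorem vizingChain_eq_none {x y : V} {C : Finset ℕ} {ℓ : ℕ}
    (h : vizingChain G q φ x y C ℓ = none) :
    ∃ u, (u = x ∨ u = y ∨ G.Adj x u) ∧ Disjoint (missing G q φ u) C := by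
  unfold vizingChain at h
  rcases hf : makeFan G q φ x y C with _ | ⟨ys, α, j⟩
  · obtain ⟨u, h1, h2⟩ := makeFanLoop_eq_none [y] y (Or.inl rfl) hf
    exact ⟨u, Or.inr h1, h2⟩
  · simp only [hf] at h
    split_ifs at h with hj hne
    exact ⟨x, Or.inl rfl,
      Finset.disjoint_iff_inter_eq_empty.2 (Finset.not_nonempty_iff_eq_empty.1 hne)⟩

end Chains

section Congr

variable {V : Type*} [Fintype V] {G : SimpleGraph V} [DecidableRel G.Adj] {q : ℕ}
  {φ ψ : Coloring V} {C : Finset ℕ}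

theorem missing_inter_congr
    (h : ∀ c ∈ C, ∀ e ∈ G.edgeSet, φ e = Status.color c ↔ ψ e = Status.color c) (x : V) :
    missing G q φ x ∩ C = missing G q ψ x ∩ C := by
  ext c
  simp only [Finset.mem_inter, mem_missing, Misses]
  constructor
  · rintro ⟨⟨h1, h2⟩, h3⟩
    exact ⟨⟨h1, fun y hy hc => h2 y hy ((h c h3 _ hy).2 hc)⟩, h3⟩
  · rintro ⟨⟨h1, h2⟩, h3⟩
    exact ⟨⟨h1, fun y hy hc => h2 y hy ((h c h3 _ hy).1 hc)⟩, h3⟩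

theorem nbrAt_congr {c : ℕ}
    (h : ∀ e ∈ G.edgeSet, φ e = Status.color c ↔ ψ e = Status.color c) (x : V) :
    nbrAt G φ x c = nbrAt G ψ x c := by
  have : (fun y => G.Adj x y ∧ φ s(x, y) = Status.color c) =
      fun y => G.Adj x y ∧ ψ s(x, y) = Status.color c := by
    funext y
    exact propext (and_congr_right fun hy => h _ hy)
  unfold nbrAt
  simp only [this]

theorem altPath_congr {c c' : ℕ}
    (h : ∀ e ∈ G.edgeSet, φ e = Status.color c ↔ ψ e = Status.color c)
    (h' : ∀ e ∈ G.edgeSet, φ e = Status.color c' ↔ ψ e = Status.color c') (s : ℕ) (x : V) :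
    altPath G φ x c c' s = altPath G ψ x c c' s := by
  induction s generalizing x c c' with
  | zero => rfl
  | succ s ih =>
    rw [altPath, altPath, nbrAt_congr h]
    rcases nbrAt G ψ x c with _ | w
    · rfl
    · simp only [ih h' h]

variable [DecidableEq V]

theorem makeFanLoop_congr
    (h : ∀ c ∈ C, ∀ e ∈ G.edgeSet, φ e = Status.color c ↔ ψ e = Status.color c)
    (x : V) (ys : List V) (z : V) :
    makeFanLoop G q φ x C ys z = makeFanLoop G q ψ x C ys z := by
  induction ys, z using makeFanLoop.induct G q φ x C with
  | case1 ys z hne η' hnone =>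
    have hm := Finset.mem_inter.1 (Finset.min'_mem _ hne)
    simp only [η'] at hnone
    have hnone' := hnone
    rw [nbrAt_congr (h _ hm.2)] at hnone'
    have e := missing_inter_congr (q := q) h z
    have hne' := e ▸ hne
    rw [makeFanLoop, makeFanLoop, dif_pos hne, dif_pos hne']
    simp only [hnone]
    simp only [e] at hnone'
    simp only [hnone', e]
  | case2 ys z hne η' w hsome hw =>
    have hm := Finset.mem_inter.1 (Finset.min'_mem _ hne)
    simp only [η'] at hsome
    have hsome' := hsome
    rw [nbrAt_congr (h _ hm.2)] at hsome'
    have e := missing_inter_congr (q := q) h z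
    have hne' := e ▸ hne
    rw [makeFanLoop, makeFanLoop, dif_pos hne, dif_pos hne']
    simp only [hsome]
    simp only [e] at hsome'
    simp only [hsome', e, if_pos hw]
  | case3 ys z hne η' w hsome hw ih =>
    have hm := Finset.mem_inter.1 (Finset.min'_mem _ hne)
    simp only [η'] at hsome
    have hsome' := hsome
    rw [nbrAt_congr (h _ hm.2)] at hsome'
    have e := missing_inter_congr (q := q) h z
    have hne' := e ▸ hne
    rw [makeFanLoop, makeFanLoop, dif_pos hne, dif_pos hne']
    simp only [hsome, if_neg hw, ih]
    simp only [e] at hsome'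
    simp only [hsome', if_neg hw]
  | case4 ys z hne =>
    have hne' := hne
    rw [missing_inter_congr h] at hne'
    rw [makeFanLoop, makeFanLoop, dif_neg hne, dif_neg hne']

theorem makeFanLoop_color_mem {x : V} (ys : List V) (z : V) {r : List V × ℕ × ℕ}
    (hr : makeFanLoop G q φ x C ys z = some r) : r.2.1 ∈ C := by
  induction ys, z using makeFanLoop.induct G q φ x C with
  | case1 ys z hne η' hnone =>
    rw [makeFanLoop, dif_pos hne] at hr
    simp only [η'] at hnone
    simp only [hnone, Option.some_inj] at hr
    subst hr
    exact (Finset.mem_inter.1 (Finset.min'_mem _ hne)).2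
  | case2 ys z hne η' w hsome hw =>
    rw [makeFanLoop, dif_pos hne] at hr
    simp only [η'] at hsome
    simp only [hsome, if_pos hw, Option.some_inj] at hr
    subst hr
    exact (Finset.mem_inter.1 (Finset.min'_mem _ hne)).2
  | case3 ys z hne η' w hsome hw ih =>
    rw [makeFanLoop, dif_pos hne] at hr
    simp only [η'] at hsome
    simp only [hsome, if_neg hw] at hr
    exact ih hr
  | case4 ys z hne =>
    rw [makeFanLoop, dif_neg hne] at hr
    cases hr

/-- The Vizing chain depends only on the edges whose colours are in the palette. -/
theorem vizingChain_congr
    (h : ∀ c ∈ C, ∀ e ∈ G.edgeSet, φ e = Status.color c ↔ ψ e = Status.color c)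
    (x y : V) (ℓ : ℕ) :
    vizingChain G q φ x y C ℓ = vizingChain G q ψ x y C ℓ := by
  have hfan : makeFan G q φ x y C = makeFan G q ψ x y C := makeFanLoop_congr h x [y] y
  unfold vizingChain
  rw [← hfan]
  rcases hf : makeFan G q φ x y C with _ | ⟨ys, α, j⟩
  · rfl
  · have hα : α ∈ C := makeFanLoop_color_mem [y] y hf
    by_cases hj : j = ys.length
    · simp only [if_pos hj]
    · have e := missing_inter_congr (q := q) h x
      by_cases hne : (missing G q φ x ∩ C).Nonempty
      · have hne' := e ▸ hne
        have hβ := (Finset.mem_inter.1 (Finset.min'_mem _ hne)).2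
        simp only [if_neg hj, dif_pos hne, dif_pos hne', Option.some_inj,
          altPath_congr (h _ hα) (h _ hβ) ℓ x]
        simp only [e]
      · have hne' := e ▸ hne
        simp only [if_neg hj, dif_neg hne, dif_neg hne']

end Congr

/-! ### One round keeps the coloring proper -/

section Round

variable {V : Type*} {G : SimpleGraph V} {φ ψ : Coloring V}

theorem IsFan.take {x y : V} {C : Finset ℕ} {ys : List V} (h : IsFan G φ x y C ys) {n : ℕ}
    (hn : n ≠ 0) : IsFan G φ x y C (ys.take n) := by
  refine ⟨?_, h.nodup.sublist (List.take_sublist _ _),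
    fun z hz => h.adj z (List.mem_of_mem_take hz), h.chain.take n⟩
  rw [List.head?_take, if_neg hn, h.head]

theorem getLast?_of_getElem? {P : List V} {i : ℕ} {u : V} (h : P[i]? = some u)
    (h' : P[i + 1]? = none) : P.getLast? = some u := by
  rw [List.getLast?_eq_getElem?]
  have h1 := (List.getElem?_eq_some_iff.1 h).1
  have h2 := List.getElem?_eq_none_iff.1 h'
  have : P.length - 1 = i := by omega
  rw [this, h]

variable [DecidableEq V]

/-- The fan that is cut off before the vertex `w` joined to the pivot by an edge of colour `α`. -/
theorem IsFan.cut {x y w : V} {α : ℕ} {C : Finset ℕ} {ys : List V} (hφ : Proper G φ)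
    (h : IsFan G φ x y C ys) (hblank : φ s(x, y) = Status.blank) (hw : w ∈ ys)
    (hcol : φ s(x, w) = Status.color α) :
    IsFan G φ x y C (ys.take (ys.idxOf w)) ∧
      (∀ z ∈ ys.take (ys.idxOf w), φ s(x, z) ≠ Status.color α) ∧
      ∃ l, (ys.take (ys.idxOf w)).getLast? = some l ∧ Misses G φ l α ∧ G.Adj x l ∧
        ys[ys.idxOf w - 1]? = some l ∧ ys.idxOf w ≠ 0 := by
  have hlt := List.idxOf_lt_length_iff.2 hw
  have hgetw : ys[ys.idxOf w] = w := List.getElem_idxOf hlt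
  have hne : ys.idxOf w ≠ 0 := by
    intro h0
    have h1 : ys[0]? = some w := by
      rw [← h0]
      exact List.getElem?_idxOf hw
    rw [← List.head?_eq_getElem?, h.head, Option.some_inj] at h1
    subst h1
    rw [hblank] at hcol
    cases hcol
  refine ⟨h.take hne, fun z hz hz' => ?_, ys[ys.idxOf w - 1], ?_, ?_, ?_, ?_, hne⟩
  · have hzy := List.mem_of_mem_take hz
    have hzw := hφ (h.adj z hzy) (h.adj w hw) hz' hcol
    subst hzw
    exact absurd ((List.mem_take_iff_idxOf_lt hw).1 hz) (lt_irrefl _)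
  · rw [List.getLast?_take, if_neg hne, List.getElem?_eq_getElem (by omega), Option.some_or]
  · obtain ⟨c, -, h1, h2⟩ := (List.isChain_iff_getElem.1 h.chain) (ys.idxOf w - 1) (by omega)
    have e : ys.idxOf w - 1 + 1 = ys.idxOf w := by omega
    simp only [e, hgetw] at h2
    rw [hcol] at h2
    cases h2
    exact h1
  · exact h.adj _ (List.getElem_mem _)
  · exact List.getElem?_eq_getElem (by omega)

/-- The effect of flipping a maximal alternating path and shifting a fan, when the path does not
meet the last vertex of the fan and the path colours do not occur in the fan. -/
theorem shiftAndColor_flipPath {x y : V} {α β : ℕ} {C : Finset ℕ} {P ys : List V}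
    (hφ : Proper G φ) (hαC : α ∈ C) (hβC : β ∈ C)
    (hP : IsAltWalk G φ x α β P) (hmax : IsMaximalWalk G φ α β P) (hβ : Misses G φ x β)
    (hf : IsFan G φ x y C ys) (hfα : ∀ z ∈ ys, φ s(x, z) ≠ Status.color α)
    (hl : ∀ l, ys.getLast? = some l → Misses G φ l α ∧ l ∉ P) :
    Proper G (shiftAndColor (flipPath φ P α β) x ys α) ∧
      (∀ e, e ≠ s(x, y) → AgreeUpTo C φ (shiftAndColor (flipPath φ P α β) x ys α) e) ∧
      ∃ c ∈ C, shiftAndColor (flipPath φ P α β) x ys α s(x, y) = Status.color c := by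
  have hxP : x ∈ P := List.mem_of_getElem? hP.head
  have hf' : IsFan G (flipPath φ P α β) x y C ys := by
    refine ⟨hf.head, hf.nodup, hf.adj, hf.chain.imp_of_mem_imp ?_⟩
    rintro a b - hb ⟨c, hc, hm, hcol⟩
    have hcα : c ≠ α := fun e => hfα b hb (e ▸ hcol)
    have hcβ : c ≠ β := fun e => hβ b (hf.adj b hb) (e ▸ hcol)
    exact ⟨c, hc, hm.flipPath_of_ne hcα hcβ, (flipPath_color_iff hcα hcβ _).2 hcol⟩
  obtain ⟨h1, h2, h3⟩ := hf'.shiftAndColor (α := α) (hφ.flipPath hP hmax hβ) hαC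
    (Misses.flipPath_of_mem hφ hP hmax hβ hxP hβ (Equiv.swap_apply_left _ _))
    (fun l hlast => (hl l hlast).1.flipPath_of_notMem (hl l hlast).2)
  exact ⟨h1, fun e he => (flipPath_agreeUpTo hαC hβC P e).trans (h2 e he), h3⟩

variable [Fintype V] [DecidableRel G.Adj]

theorem cutFan_of_path {x w : V} {α β ℓ : ℕ} (hℓ : 1 ≤ ℓ) (hw : nbrAt G φ x α = some w)
    (ys : List V) : cutFan ys (altPath G φ x α β ℓ) = ys.take (ys.idxOf w) := by
  obtain ⟨s, rfl⟩ : ∃ s, ℓ = s + 1 := ⟨ℓ - 1, by omega⟩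
  rw [altPath_of_nbrAt hw]
  simp only [cutFan, List.getElem?_cons_succ, altPath_getElem?_zero]

/-- Augmenting with a Vizing chain whose path has fewer than `ℓ` edges colours the uncolored edge,
keeps the coloring proper, and recolours edges only within the palette. -/
theorem IsVizingChain.augment {x y : V} {C : Finset ℕ} {ℓ : ℕ} {K : VizingChain V}
    (hφ : Proper G φ) (hblank : φ s(x, y) = Status.blank) (hℓ : 1 ≤ ℓ)
    (hK : IsVizingChain G φ x y C ℓ K) (hlen : K.path.length - 1 < ℓ) :
    Proper G (augment φ x K) ∧ (∀ e, e ≠ s(x, y) → AgreeUpTo C φ (augment φ x K) e) ∧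
      ∃ c ∈ C, EdgeColoring.augment φ x K s(x, y) = Status.color c := by
  obtain ⟨ys, P, α, β⟩ := K
  obtain ⟨hf, hα, hlast, hpath⟩ := hK
  simp only at hf hα hlast hpath hlen
  simp only [EdgeColoring.augment]
  rcases hpath with ⟨rfl, hx⟩ | ⟨hβC, hβ, w, hw, hwn, rfl⟩
  · have hc : cutFan ys [x] = ys := rfl
    rw [hc, ite_self, flipPath_singleton]
    exact hf.shiftAndColor hφ hα hx hlast
  · obtain ⟨hxw, hwcol⟩ := nbrAt_eq_some hwn
    rw [cutFan_of_path hℓ hwn]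
    obtain ⟨hf', hf'α, l, hl, hlα, hxl, hlget, hw0⟩ := hf.cut hφ hblank hw hwcol
    set P := altPath G φ x α β ℓ
    have hP : IsAltWalk G φ x α β P := isAltWalk_altPath x α β ℓ
    have hmax : IsMaximalWalk G φ α β P := isMaximalWalk_altPath (show P.length ≤ ℓ by omega)
    have hxP : x ∈ P := List.mem_of_getElem? hP.head
    -- a vertex of the path that misses `α` is its last vertex
    have hend : ∀ u, u ≠ x → Misses G φ u α → u ∈ P → P.getLast? = some u := by
      intro u hux hu huP
      obtain ⟨i, hi⟩ := List.mem_iff_getElem?.1 huP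
      exact getLast?_of_getElem? hi (hP.getLast?_of_misses hu hux hi)
    split_ifs with hcond
    · rw [hl] at hcond
      have hlP : l ∈ P := List.mem_of_getLast? hcond
      have hxα : Misses G (flipPath φ P α β) x α :=
        Misses.flipPath_of_mem hφ hP hmax hβ hxP hβ (Equiv.swap_apply_left _ _)
      have hF : IsFan G (flipPath φ P α β) x y C ys := by
        refine ⟨hf.head, hf.nodup, hf.adj, ?_⟩
        rw [List.isChain_iff_getElem]
        intro i hi
        obtain ⟨c, hc, hm, hcol⟩ := (List.isChain_iff_getElem.1 hf.chain) i hi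
        have hadj := hf.adj _ (List.getElem_mem hi)
        have hcβ : c ≠ β := fun e => hβ _ hadj (e ▸ hcol)
        by_cases hcα : c = α
        · -- here the fan step is the one from `l` to `w`; the flip turns `α` into `β` at both
          subst hcα
          have hiw : ys[i + 1] = w := hφ hadj hxw hcol hwcol
          have hidx : ys.idxOf w = i + 1 := by
            rw [← hiw]
            exact hf.nodup.idxOf_getElem _ _
          have hil : ys[i] = l := by
            rw [hidx, Nat.add_sub_cancel, List.getElem?_eq_getElem (by omega),
              Option.some_inj] at hlget
            exact hlget
          refine ⟨β, hβC, ?_, ?_⟩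
          · rw [hil]
            exact Misses.flipPath_of_mem hφ hP hmax hβ hlP hlα (Equiv.swap_apply_right _ _)
          · rw [flipPath_at_of_mem hφ hP hmax hβ hxP hadj, hcol, Equiv.swap_apply_left]
        · exact ⟨c, hc, hm.flipPath_of_ne hcα hcβ, (flipPath_color_iff hcα hcβ _).2 hcol⟩
      have hL : ∀ L, ys.getLast? = some L → Misses G (flipPath φ P α β) L α := by
        intro L hL
        refine (hlast L hL).flipPath_of_notMem fun hLP => ?_
        have hLx : L ≠ x := (hf.adj L (List.mem_of_getLast? hL)).ne'
        have := hend L hLx (hlast L hL) hLP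
        rw [hcond, Option.some_inj] at this
        subst this
        rw [List.getLast?_eq_getElem?] at hL
        have hlt := List.idxOf_lt_length_iff.2 hw
        have := (List.getElem?_inj (by omega) hf.nodup).1 (hlget.trans hL.symm)
        omega
      obtain ⟨h1, h2, h3⟩ := hF.shiftAndColor (α := α) (hφ.flipPath hP hmax hβ) hα hxα hL
      exact ⟨h1, fun e he => (flipPath_agreeUpTo hα hβC P e).trans (h2 e he), h3⟩
    · refine shiftAndColor_flipPath hφ hα hβC hP hmax hβ hf' hf'α fun l' hl' => ?_
      rw [hl, Option.some_inj] at hl'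
      subst hl'
      exact ⟨hlα, fun hlP => hcond ((hend l hxl.ne' hlα hlP).trans hl.symm)⟩

/-- If the path of the Vizing chain has `ℓ` edges, then moving the uncolored edge to one of them
keeps the coloring proper and recolours the other edges only within the palette. -/
theorem IsVizingChain.moveUncolored {x y : V} {C : Finset ℕ} {ℓ ℓ' : ℕ} {K : VizingChain V}
    (hφ : Proper G φ) (hblank : φ s(x, y) = Status.blank) (h1 : 1 ≤ ℓ') (h2 : ℓ' ≤ ℓ)
    (hK : IsVizingChain G φ x y C ℓ K) (hlen : ¬ K.path.length - 1 < ℓ) :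
    ∃ a b, K.path[ℓ' - 1]? = some a ∧ K.path[ℓ']? = some b ∧ G.Adj a b ∧
      (∃ c ∈ C, φ s(a, b) = Status.color c) ∧
      Proper G (moveUncolored φ x K ℓ') ∧ moveUncolored φ x K ℓ' s(a, b) = Status.blank ∧
      (∀ e, e ≠ s(x, y) → e ≠ s(a, b) → AgreeUpTo C φ (moveUncolored φ x K ℓ') e) ∧
      ∃ c ∈ C, EdgeColoring.moveUncolored φ x K ℓ' s(x, y) = Status.color c := by
  obtain ⟨ys, P, α, β⟩ := K
  obtain ⟨hf, hα, hlast, hpath⟩ := hK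
  simp only at hf hα hlast hpath hlen
  rcases hpath with ⟨rfl, -⟩ | ⟨hβC, hβ, w, hw, hwn, rfl⟩
  · simp at hlen
    omega
  obtain ⟨hxw, hwcol⟩ := nbrAt_eq_some hwn
  obtain ⟨hf', hf'α, l, hl, hlα, hxl, -, -⟩ := hf.cut hφ hblank hw hwcol
  have hcut := cutFan_of_path (β := β) (h1.trans h2) hwn ys
  set P := altPath G φ x α β ℓ
  have hP : IsAltWalk G φ x α β P := isAltWalk_altPath x α β ℓ
  obtain ⟨a, ha⟩ : ∃ a, P[ℓ' - 1]? = some a := ⟨_, List.getElem?_eq_getElem (by omega)⟩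
  obtain ⟨b, hb⟩ : ∃ b, P[ℓ']? = some b := ⟨_, List.getElem?_eq_getElem (by omega)⟩
  have hb' : P[ℓ' - 1 + 1]? = some b := by rwa [Nat.sub_add_cancel h1]
  obtain ⟨hab, habcol⟩ := hP.step ha hb'
  have hcC : altColor α β (ℓ' - 1) ∈ C := by
    rcases altColor_mem (α := α) (β := β) (ℓ' - 1) with h | h <;> rw [h] <;> assumption
  have hne : s(a, b) ≠ s(x, y) := by
    intro e
    rw [e, hblank] at habcol
    cases habcol
  set φ₁ := Function.update φ s(a, b) Status.blank with hφ₁def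
  have hφ₁ : Proper G φ₁ := hφ.update _ (by simp)
  have hmono : ∀ {u c}, Misses G φ u c → Misses G φ₁ u c := fun h => h.update _ (by simp)
  have hsame : ∀ {e}, e ≠ s(a, b) → φ₁ e = φ e := fun h => Function.update_of_ne h _ _
  have htake : ∀ {i : ℕ} {u : V}, (P.take ℓ')[i]? = some u → i < ℓ' ∧ P[i]? = some u := by
    intro i u h
    rw [List.getElem?_take] at h
    split_ifs at h with hi
    exact ⟨hi, h⟩
  -- without the edge `ab`, the initial segment of the path is a maximal alternating path
  have hP₁ : IsAltWalk G φ₁ x α β (P.take ℓ') := by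
    refine ⟨?_, fun i u z hu hz => ?_⟩
    · rw [List.getElem?_take_of_lt (by omega), hP.head]
    · obtain ⟨-, hu⟩ := htake hu
      obtain ⟨hi, hz⟩ := htake hz
      obtain ⟨h3, h4⟩ := hP.step hu hz
      refine ⟨h3, ?_⟩
      rw [hsame, h4]
      intro e
      rcases Sym2.eq_iff.1 e with ⟨-, rfl⟩ | ⟨rfl, rfl⟩
      · have := hP.injective hφ hβ hz hb
        omega
      · have := hP.injective hφ hβ hu hb
        omega
  have hmax₁ : IsMaximalWalk G φ₁ α β (P.take ℓ') := by
    intro i u hu hn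
    obtain ⟨hi, hu⟩ := htake hu
    have hi' : i = ℓ' - 1 := by
      by_contra hcon
      rw [List.getElem?_take_of_lt (by omega), List.getElem?_eq_none_iff] at hn
      omega
    subst hi'
    rw [ha, Option.some_inj] at hu
    subst hu
    intro z hz hcol
    by_cases e : s(a, z) = s(a, b)
    · rw [e, hφ₁def, Function.update_self] at hcol
      cases hcol
    · rw [hsame e] at hcol
      exact e (by rw [hφ hz hab hcol habcol])
  have hf₁ : IsFan G φ₁ x y C (ys.take (ys.idxOf w)) := by
    refine ⟨hf'.head, hf'.nodup, hf'.adj, hf'.chain.imp_of_mem_imp ?_⟩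
    rintro u v - hv ⟨c, hc, hm, hcol⟩
    refine ⟨c, hc, hmono hm, ?_⟩
    rw [hsame, hcol]
    intro e
    rw [e] at hcol
    rcases altColor_mem (α := α) (β := β) (ℓ' - 1) with h | h
    · exact hf'α v hv (by rw [e, habcol, h])
    · exact hβ v (hf'.adj v hv) (by rw [e, habcol, h])
  obtain ⟨g1, g2, g3⟩ := shiftAndColor_flipPath hφ₁ hα hβC hP₁ hmax₁ (hmono hβ) hf₁
    (fun z hz => by
      by_cases e : s(x, z) = s(a, b)
      · rw [e, hφ₁def, Function.update_self]
        simp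
      · rw [hsame e]
        exact hf'α z hz)
    (fun l' hl' => by
      rw [hl, Option.some_inj] at hl'
      subst hl'
      refine ⟨hmono hlα, fun hlP => ?_⟩
      obtain ⟨i, hi⟩ := List.mem_iff_getElem?.1 hlP
      obtain ⟨hi', hi⟩ := htake hi
      have := List.getElem?_eq_none_iff.1 (hP.getLast?_of_misses hlα hxl.ne' hi)
      omega)
  have hmove : EdgeColoring.moveUncolored φ x ⟨ys, P, α, β⟩ ℓ' =
      shiftAndColor (flipPath φ₁ (P.take ℓ') α β) x (ys.take (ys.idxOf w)) α := by
    simp only [EdgeColoring.moveUncolored, List.getD_eq_getElem?_getD, ha, hb, Option.getD_some,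
      hcut, hφ₁def]
  rw [hmove]
  refine ⟨a, b, ha, hb, hab, ⟨_, hcC, habcol⟩, g1, ?_, fun e he he' => ?_, g3⟩
  · exact (g2 _ hne).blank_iff.2 (Function.update_self _ _ _)
  · have := g2 e he
    rwa [AgreeUpTo, hsame he'] at this

end Round

/-! ### How often the alternating paths lead to a given vertex -/

section Counting

variable {V : Type*} [Fintype V] {G : SimpleGraph V} [DecidableRel G.Adj] {q : ℕ} {φ : Coloring V}

open Classical in
/-- The positions at which the `αβ`-path from `x` (with at most `ℓ` edges) visits `v`; none if the
colour `β` is present at `x`. -/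
noncomputable def visits (G : SimpleGraph V) [DecidableRel G.Adj] (φ : Coloring V) (ℓ : ℕ) (v : V)
    (α β : ℕ) (x : V) : Finset ℕ :=
  (Finset.range (ℓ + 1)).filter fun i => Misses G φ x β ∧ (altPath G φ x α β ℓ)[i]? = some v

theorem sum_card_visits_le (hφ : Proper G φ) (ℓ : ℕ) (v : V) (α β : ℕ) :
    ∑ x, (visits G φ ℓ v α β x).card ≤ 2 := by
  classical
  rw [← Finset.card_sigma]
  refine (Finset.card_le_card_of_injOn (t := (Finset.univ : Finset Bool))
    (fun p => decide (Even p.2)) (fun _ _ => Finset.mem_coe.2 (Finset.mem_univ _)) ?_).trans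
    (by simp)
  rintro ⟨x, i⟩ hx ⟨x', i'⟩ hx' h
  simp only [visits, Finset.mem_coe, Finset.mem_sigma, Finset.mem_univ, true_and,
    Finset.mem_filter] at hx hx'
  obtain ⟨rfl, rfl⟩ := (isAltWalk_altPath x α β ℓ).eq_of_parity hφ (isAltWalk_altPath x' α β ℓ)
    hx.2.1 hx'.2.1 hx.2.2 hx'.2.2 (by simpa using h)
  rfl

variable [DecidableEq V]

theorem vizingChain_path {x y : V} {C : Finset ℕ} {ℓ : ℕ} {K : VizingChain V}
    (h : vizingChain G q φ x y C ℓ = some K) :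
    K.path = [x] ∨ (K.α ∈ C ∧ K.β ∈ C ∧ Misses G φ x K.β ∧
      K.path = altPath G φ x K.α K.β ℓ) := by
  unfold vizingChain at h
  rcases hf : makeFan G q φ x y C with _ | ⟨ys, α, j⟩
  · simp [hf] at h
  · simp only [hf] at h
    split_ifs at h with hj hne
    · rw [Option.some_inj] at h
      subst h
      exact Or.inl rfl
    · rw [Option.some_inj] at h
      subst h
      have hm := Finset.mem_inter.1 (Finset.min'_mem _ hne)
      exact Or.inr ⟨makeFanLoop_color_mem [y] y hf, hm.2, (mem_missing.1 hm.1).2, rfl⟩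

/-- The expectation of `g` at the new uncolored edge and its pivot, if the current uncolored edge is
`xy` with pivot `x` and the palette is `C`; outcomes in which the uncolored edge is not moved
count zero. -/
noncomputable def moveExpect (G : SimpleGraph V) [DecidableRel G.Adj] (q ℓ : ℕ) (φ : Coloring V)
    (C : Finset ℕ) (g : V → V → ℝ≥0∞) (x y : V) : ℝ≥0∞ :=
  match vizingChain G q φ x y C ℓ with
  | none => 0
  | some K =>
    if K.path.length - 1 < ℓ then 0
    else expect (uniformOn (Finset.Icc 1 ℓ) 1) fun ℓ' =>
      g (K.path.getD (ℓ' - 1) x) (K.path.getD ℓ' x)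

theorem moveExpect_sum {ι : Type*} (ℓ : ℕ) (C : Finset ℕ) (s : Finset ι) (c : ι → ℝ≥0∞)
    (g : ι → V → V → ℝ≥0∞) (x y : V) :
    moveExpect G q ℓ φ C (fun a b => ∑ i ∈ s, c i * g i a b) x y =
      ∑ i ∈ s, c i * moveExpect G q ℓ φ C (g i) x y := by
  unfold moveExpect
  rcases vizingChain G q φ x y C ℓ with _ | K
  · simp
  · by_cases h : K.path.length - 1 < ℓ
    · simp [h]
    · simp only [if_neg h, expect_sum, expect_mul_left]

/-- A pivot `x` leads to the vertex `v` at the position `f ℓ'` of its path only through a pair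
of palette colours. -/
theorem moveExpect_le {ℓ : ℕ} (hℓ : 1 ≤ ℓ) {C : Finset ℕ} (v : V) {f : ℕ → ℕ}
    (hf : Set.InjOn f (Finset.Icc 1 ℓ)) (hf' : ∀ i ∈ Finset.Icc 1 ℓ, f i ≤ ℓ)
    {g : V → V → ℝ≥0∞} {x y : V}
    (hg : ∀ P : List V, ∀ i ∈ Finset.Icc 1 ℓ,
      g (P.getD (i - 1) x) (P.getD i x) = if P.getD (f i) x = v then 1 else 0) :
    moveExpect G q ℓ φ C g x y ≤
      (ℓ : ℝ≥0∞)⁻¹ * ∑ p ∈ C ×ˢ C, ((visits G φ ℓ v p.1 p.2 x).card : ℝ≥0∞) := by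
  unfold moveExpect
  rcases h : vizingChain G q φ x y C ℓ with _ | K
  · simp
  by_cases hlen : K.path.length - 1 < ℓ
  · simp [hlen]
  simp only [if_neg hlen]
  rcases vizingChain_path h with hP | ⟨hα, hβ, hmiss, hP⟩
  · simp [hP] at hlen
    omega
  rw [expect_uniformOn _ (Finset.nonempty_Icc.2 hℓ), Nat.card_Icc, Nat.add_sub_cancel]
  refine mul_le_mul_right ?_ _
  have hmem : (K.α, K.β) ∈ C ×ˢ C := Finset.mem_product.2 ⟨hα, hβ⟩
  refine le_trans ?_ (Finset.single_le_sum (f := fun p : ℕ × ℕ =>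
    ((visits G φ ℓ v p.1 p.2 x).card : ℝ≥0∞)) (fun _ _ => zero_le) hmem)
  rw [Finset.sum_congr rfl (hg K.path), ← Finset.sum_filter, Finset.sum_const, nsmul_one]
  rw [Nat.cast_le]
  refine Finset.card_le_card_of_injOn f ?_ (hf.mono ?_)
  · intro i hi
    rw [Finset.mem_coe, Finset.mem_filter] at hi
    have hfi := hf' i hi.1
    have hget : K.path[f i]? = some v := by
      have hlt : f i < K.path.length := by omega
      rw [List.getElem?_eq_getElem hlt, ← List.getD_eq_getElem _ x hlt, hi.2]
    simp only [visits, Finset.mem_coe, Finset.mem_filter, Finset.mem_range]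
    exact ⟨by omega, hmiss, hP ▸ hget⟩
  · exact fun i hi => (Finset.mem_filter.1 hi).1

/-- If the weights `w x y` of the pairs with pivot `x` add up to at most `m` for every `x`, then
after one move the total weight at a given position `v` is at most `2κ²/ℓ` times `m`. -/
theorem sum_moveExpect_le (hφ : Proper G φ) {ℓ κ : ℕ} (hℓ : 1 ≤ ℓ) {C : Finset ℕ} (hC : C.card ≤ κ)
    (v : V) {f : ℕ → ℕ}
    (hf : Set.InjOn f (Finset.Icc 1 ℓ)) (hf' : ∀ i ∈ Finset.Icc 1 ℓ, f i ≤ ℓ)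
    {g : V → V → ℝ≥0∞}
    (hg : ∀ (x : V) (P : List V), ∀ i ∈ Finset.Icc 1 ℓ,
      g (P.getD (i - 1) x) (P.getD i x) = if P.getD (f i) x = v then 1 else 0)
    {w : V → V → ℝ≥0∞} {m : ℝ≥0∞} (hw : ∀ x, ∑ y, w x y ≤ m) :
    ∑ x, ∑ y, w x y * moveExpect G q ℓ φ C g x y ≤ m * ((ℓ : ℝ≥0∞)⁻¹ * (2 * (κ : ℝ≥0∞) ^ 2)) := by
  have h1 : ∀ x, ∑ y, w x y * moveExpect G q ℓ φ C g x y ≤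
      m * ((ℓ : ℝ≥0∞)⁻¹ * ∑ p ∈ C ×ˢ C, ((visits G φ ℓ v p.1 p.2 x).card : ℝ≥0∞)) := by
    intro x
    refine (Finset.sum_le_sum fun y _ =>
      mul_le_mul_right (moveExpect_le hℓ v hf hf' (hg x)) (w x y)).trans ?_
    rw [← Finset.sum_mul]
    exact mul_le_mul_left (hw x) _
  refine (Finset.sum_le_sum fun x _ => h1 x).trans ?_
  rw [← Finset.mul_sum, ← Finset.mul_sum]
  refine mul_le_mul_right (mul_le_mul_right ?_ _) _
  rw [Finset.sum_comm]
  have h2 : ∀ p ∈ C ×ˢ C, ∑ x, ((visits G φ ℓ v p.1 p.2 x).card : ℝ≥0∞) ≤ 2 := by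
    intro p _
    exact_mod_cast sum_card_visits_le hφ ℓ v p.1 p.2
  refine (Finset.sum_le_card_nsmul _ _ _ h2).trans ?_
  rw [Finset.card_product, nsmul_eq_mul, mul_comm, sq]
  refine mul_le_mul_right ?_ _
  exact_mod_cast Nat.mul_le_mul hC hC

/-! ### The position of the flag -/

/-- The indicator of the event that `v` is an end of `xy`. -/
noncomputable def touch (v x y : V) : ℝ≥0∞ := (if x = v then 1 else 0) + if y = v then 1 else 0

/-- An upper bound for the probability that processing the uncolored edge `xy` with pivot `x` ends
with a flag at the vertex `v`, if `t` rounds are left and `Q` is the set of colours not sampled so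
far. It is computed from the coloring `φ` before the edge was processed: the later colorings agree
with `φ` on the colours of `Q`. -/
noncomputable def flagMass (G : SimpleGraph V) [DecidableRel G.Adj] (q κ ℓ : ℕ) (φ : Coloring V)
    (v : V) : ℕ → Finset ℕ → V → V → ℝ≥0∞
  | 0, _, x, y => touch v x y
  | t + 1, Q, x, y => expect (samplePalette Q κ) fun C =>
      (if vizingChain G q φ x y C ℓ = none then touch v x y else 0) +
        moveExpect G q ℓ φ C (flagMass G q κ ℓ φ v t (Q \ C)) x y

theorem sum_touch_le {w : V → V → ℝ≥0∞} {m : ℝ≥0∞} (hrow : ∀ x, ∑ y, w x y ≤ m)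
    (hcol : ∀ y, ∑ x, w x y ≤ m) (v : V) : ∑ x, ∑ y, w x y * touch v x y ≤ 2 * m := by
  simp only [touch, mul_add, Finset.sum_add_distrib]
  rw [two_mul]
  refine add_le_add ?_ ?_
  · simp only [mul_ite, mul_one, mul_zero]
    rw [Finset.sum_comm]
    simpa using hrow v
  · simpa using hcol v

/-- The construction of the Vizing chain fails with small probability: its failure means that
the palette misses `M(φ, u)` for one of at most `Δ + 2` vertices `u`. -/
theorem expect_vizingChain_eq_none_le {Q : Finset ℕ} (hQ : Q ⊆ Finset.Icc 1 q) (hne : Q.Nonempty)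
    (κ ℓ : ℕ) {ρ : ℝ≥0∞} (hρ : (Q.card : ℝ≥0∞)⁻¹ * (G.maxDegree : ℝ≥0∞) ≤ ρ) (x y : V) :
    expect (samplePalette Q κ) (fun C => if vizingChain G q φ x y C ℓ = none then 1 else 0) ≤
      ((G.maxDegree : ℝ≥0∞) + 2) * ρ ^ κ := by
  have h1 : ∀ C ∈ (samplePalette Q κ).support,
      (if vizingChain G q φ x y C ℓ = none then 1 else 0 : ℝ≥0∞) ≤
        ∑ u ∈ insert x (insert y (G.neighborFinset x)),
          if Disjoint (missing G q φ u) C then 1 else 0 := by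
    intro C _
    by_cases h : vizingChain G q φ x y C ℓ = none
    · obtain ⟨u, hu, hd⟩ := vizingChain_eq_none h
      rw [if_pos h]
      have hmem : u ∈ insert x (insert y (G.neighborFinset x)) := by simpa using hu
      refine le_trans (le_of_eq ?_) (Finset.single_le_sum (fun _ _ => zero_le) hmem)
      rw [if_pos hd]
    · simp [h]
  refine (expect_mono h1).trans ?_
  rw [expect_sum]
  refine (Finset.sum_le_card_nsmul _ _ (ρ ^ κ) fun u _ => ?_).trans ?_
  · refine samplePalette_disjoint_le hne _ (le_trans (mul_le_mul_right ?_ _) hρ) κ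
    exact_mod_cast card_sdiff_missing_le hQ u
  · rw [nsmul_eq_mul]
    refine mul_le_mul_left ?_ _
    have h2 := G.degree_le_maxDegree x
    rw [← SimpleGraph.card_neighborFinset_eq_degree] at h2
    have h3 := Finset.card_insert_le x (insert y (G.neighborFinset x))
    have h4 := Finset.card_insert_le y (G.neighborFinset x)
    exact_mod_cast (show _ ≤ G.maxDegree + 2 by omega)

/-- The main estimate. If the initial position is weighted such that every vertex carries the weight
at most `m`, both as a pivot and as the other end, then the total weight of flags at `v` is small:
every round halves the weight at each vertex, and in each round the construction of the Vizing
chain fails with probability at most `(Δ + 2) ρ ^ κ`. -/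
theorem sum_flagMass_le (hφ : Proper G φ) {κ ℓ s : ℕ} (hℓ : 1 ≤ ℓ)
    (hκℓ : (ℓ : ℝ≥0∞)⁻¹ * (2 * (κ : ℝ≥0∞) ^ 2) ≤ 2⁻¹) (hs : 1 ≤ s) {ρ : ℝ≥0∞}
    (hρ : (((G.maxDegree + s : ℕ) : ℝ≥0∞))⁻¹ * (G.maxDegree : ℝ≥0∞) ≤ ρ) (v : V) (t : ℕ) :
    ∀ (Q : Finset ℕ) (w : V → V → ℝ≥0∞) (m : ℝ≥0∞), Q ⊆ Finset.Icc 1 q →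
      G.maxDegree + s + κ * t ≤ Q.card →
      (∀ x, ∑ y, w x y ≤ m) → (∀ y, ∑ x, w x y ≤ m) →
      ∑ x, ∑ y, w x y * flagMass G q κ ℓ φ v t Q x y ≤
        m * (4 * (((G.maxDegree : ℝ≥0∞) + 2) * ρ ^ κ) + 2 * 2⁻¹ ^ t) := by
  set δ := ((G.maxDegree : ℝ≥0∞) + 2) * ρ ^ κ with hδ
  induction t with
  | zero =>
    intro Q w m _ _ hrow hcol
    simp only [flagMass]
    refine (sum_touch_le hrow hcol v).trans ?_
    rw [pow_zero, mul_one, mul_comm, mul_add]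
    exact le_add_self
  | succ t ih =>
    intro Q w m hQ hcard hrow hcol
    have hne : Q.Nonempty := Finset.card_pos.1 (by omega)
    have hρQ : (Q.card : ℝ≥0∞)⁻¹ * (G.maxDegree : ℝ≥0∞) ≤ ρ := by
      refine le_trans (mul_le_mul_left (ENNReal.inv_le_inv.2 ?_) _) hρ
      exact_mod_cast (by omega : G.maxDegree + s ≤ Q.card)
    have hfail : ∀ x y, expect (samplePalette Q κ)
        (fun C => if vizingChain G q φ x y C ℓ = none then touch v x y else 0) ≤
          touch v x y * δ := by
      intro x y
      have := expect_vizingChain_eq_none_le (φ := φ) hQ hne κ ℓ hρQ x y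
      refine le_trans (le_of_eq ?_) (mul_le_mul_right this (touch v x y))
      rw [← expect_mul_left]
      simp only [mul_ite, mul_one, mul_zero]
    have hmove : ∀ C ∈ (samplePalette Q κ).support,
        ∑ x, ∑ y, w x y * moveExpect G q ℓ φ C (flagMass G q κ ℓ φ v t (Q \ C)) x y ≤
          (m * 2⁻¹) * (4 * δ + 2 * 2⁻¹ ^ t) := by
      intro C hC
      obtain ⟨hCQ, hCκ⟩ := samplePalette_support hne κ C hC
      -- `w'` is the weight of the positions after the move
      set w' : V → V → ℝ≥0∞ := fun a b => ∑ x, ∑ y, w x y * moveExpect G q ℓ φ C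
        (fun a' b' => if a' = a ∧ b' = b then 1 else 0) x y with hw'
      have hrow' : ∀ a, ∑ b, w' a b ≤ m * 2⁻¹ := by
        intro a
        have h1 := sum_moveExpect_le (q := q) (w := w) hφ hℓ hCκ a (f := fun i => i - 1)
          (g := fun a' _ => if a' = a then 1 else 0)
          (fun i hi j hj h => by
            simp only [Finset.coe_Icc, Set.mem_Icc] at hi hj h
            omega)
          (fun i hi => by rw [Finset.mem_Icc] at hi; omega)
          (fun _ _ _ _ => rfl) hrow
        refine le_trans (le_of_eq ?_) (h1.trans (mul_le_mul_right hκℓ m))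
        simp only [hw']
        rw [Finset.sum_comm]
        refine Finset.sum_congr rfl fun x _ => ?_
        rw [Finset.sum_comm]
        refine Finset.sum_congr rfl fun y _ => ?_
        rw [← Finset.mul_sum]
        congr 1
        have := moveExpect_sum (G := G) (q := q) (φ := φ) ℓ C Finset.univ (fun _ => 1)
          (fun (b : V) a' b' => if a' = a ∧ b' = b then 1 else 0) x y
        simp only [one_mul] at this
        rw [← this]
        congr 1
        funext a' b'
        by_cases h : a' = a <;> simp [h]
      have hcol' : ∀ b, ∑ a, w' a b ≤ m * 2⁻¹ := by
        intro b
        have h1 := sum_moveExpect_le (q := q) (w := w) hφ hℓ hCκ b (f := fun i => i)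
          (g := fun _ b' => if b' = b then 1 else 0)
          (fun i hi j hj h => h)
          (fun i hi => (Finset.mem_Icc.1 hi).2)
          (fun _ _ _ _ => rfl) hrow
        refine le_trans (le_of_eq ?_) (h1.trans (mul_le_mul_right hκℓ m))
        simp only [hw']
        rw [Finset.sum_comm]
        refine Finset.sum_congr rfl fun x _ => ?_
        rw [Finset.sum_comm]
        refine Finset.sum_congr rfl fun y _ => ?_
        rw [← Finset.mul_sum]
        congr 1
        have := moveExpect_sum (G := G) (q := q) (φ := φ) ℓ C Finset.univ (fun _ => 1)
          (fun (a : V) a' b' => if a' = a ∧ b' = b then 1 else 0) x y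
        simp only [one_mul] at this
        rw [← this]
        congr 1
        funext a' b'
        by_cases h : b' = b <;> simp [h]
      refine le_trans (le_of_eq ?_) (ih (Q \ C) w' (m * 2⁻¹) (Finset.sdiff_subset.trans hQ) ?_
        hrow' hcol')
      · set g := flagMass G q κ ℓ φ v t (Q \ C)
        have h1 : ∀ x y, moveExpect G q ℓ φ C g x y =
            ∑ p : V × V, g p.1 p.2 * moveExpect G q ℓ φ C
              (fun a' b' => if a' = p.1 ∧ b' = p.2 then 1 else 0) x y := by
          intro x y
          rw [← moveExpect_sum]
          congr 1
          funext a b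
          rw [Finset.sum_eq_single (a, b)]
          · simp
          · intro p _ hp
            rw [if_neg, mul_zero]
            rintro ⟨rfl, rfl⟩
            exact hp rfl
          · simp
        simp only [h1, hw']
        rw [← Fintype.sum_prod_type' (f := fun x y => w x y * ∑ p : V × V, g p.1 p.2 *
            moveExpect G q ℓ φ C (fun a' b' => if a' = p.1 ∧ b' = p.2 then 1 else 0) x y),
          ← Fintype.sum_prod_type' (f := fun a b => (∑ x, ∑ y, w x y * moveExpect G q ℓ φ C
            (fun a' b' => if a' = a ∧ b' = b then 1 else 0) x y) * g a b)]
        simp only [Finset.mul_sum]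
        rw [Finset.sum_comm]
        refine Finset.sum_congr rfl fun p _ => ?_
        rw [← Fintype.sum_prod_type' (f := fun x y => w x y * moveExpect G q ℓ φ C
          (fun a' b' => if a' = p.1 ∧ b' = p.2 then 1 else 0) x y), Finset.sum_mul]
        exact Finset.sum_congr rfl fun r _ => by ring
      · have h1 := Finset.le_card_sdiff C Q
        have h2 : κ * (t + 1) = κ * t + κ := by ring
        omega
    simp only [flagMass]
    calc ∑ x, ∑ y, w x y * expect (samplePalette Q κ) (fun C =>
            (if vizingChain G q φ x y C ℓ = none then touch v x y else 0) +
              moveExpect G q ℓ φ C (flagMass G q κ ℓ φ v t (Q \ C)) x y)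
        = (∑ x, ∑ y, w x y * expect (samplePalette Q κ)
            (fun C => if vizingChain G q φ x y C ℓ = none then touch v x y else 0)) +
          expect (samplePalette Q κ) (fun C => ∑ x, ∑ y, w x y *
            moveExpect G q ℓ φ C (flagMass G q κ ℓ φ v t (Q \ C)) x y) := by
          simp only [expect_add, mul_add, Finset.sum_add_distrib, expect_sum, expect_mul_left]
      _ ≤ (∑ x, ∑ y, w x y * (touch v x y * δ)) + (m * 2⁻¹) * (4 * δ + 2 * 2⁻¹ ^ t) := by
          refine add_le_add ?_ (expect_le_const hmove)
          exact Finset.sum_le_sum fun x _ => Finset.sum_le_sum fun y _ =>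
            mul_le_mul_right (hfail x y) _
      _ ≤ 2 * m * δ + (m * 2⁻¹) * (4 * δ + 2 * 2⁻¹ ^ t) := by
          refine add_le_add ?_ le_rfl
          simp only [← mul_assoc, ← Finset.sum_mul]
          exact mul_le_mul_left (sum_touch_le hrow hcol v) _
      _ = m * (4 * δ + 2 * 2⁻¹ ^ (t + 1)) := by
          have h2 : (2⁻¹ : ℝ≥0∞) * 4 = 2 := by
            rw [show (4 : ℝ≥0∞) = 2 * 2 by norm_num, ← mul_assoc,
              ENNReal.inv_mul_cancel (by norm_num) (by norm_num), one_mul]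
          calc 2 * m * δ + (m * 2⁻¹) * (4 * δ + 2 * 2⁻¹ ^ t)
              = 2 * m * δ + m * ((2⁻¹ * 4) * δ) + m * (2 * (2⁻¹ ^ t * 2⁻¹)) := by ring
            _ = m * (4 * δ + 2 * 2⁻¹ ^ (t + 1)) := by rw [h2, pow_succ]; ring

end Counting

/-! ### Processing one edge -/

section ColorOne

variable {V : Type*} {G : SimpleGraph V} {φ₀ φ : Coloring V}

/-- The situation at the start of a round in the processing of one edge: the uncolored edge is `xy`,
the other blank edges are those of `B`, and the coloring agrees with the coloring `φ₀` before the
edge was processed on the flags and on the colours of `Q`. -/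
structure RoundState (G : SimpleGraph V) (φ₀ : Coloring V) (B : Set (Sym2 V)) (Q : Finset ℕ)
    (φ : Coloring V) (x y : V) : Prop where
  adj : G.Adj x y
  proper : Proper G φ
  notMem : s(x, y) ∉ B
  blank : ∀ e ∈ G.edgeSet, φ e = Status.blank ↔ e ∈ B ∨ e = s(x, y)
  flag : ∀ e ∈ G.edgeSet, φ e = Status.flg ↔ φ₀ e = Status.flg
  color : ∀ c ∈ Q, ∀ e ∈ G.edgeSet, φ e = Status.color c ↔ φ₀ e = Status.color c

/-- The situation after an edge has been processed: `B` is the set of blank edges, and there is at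
most one new flag. -/
structure Outcome (G : SimpleGraph V) (φ₀ : Coloring V) (B : Set (Sym2 V)) (φ : Coloring V) :
    Prop where
  proper : Proper G φ
  blank : ∀ e ∈ G.edgeSet, φ e = Status.blank ↔ e ∈ B
  flag : ∃ f, ∀ e ∈ G.edgeSet, e ≠ f → φ e = Status.flg → φ₀ e = Status.flg

/-- Some edge at `v` is flagged in `φ` but not in `φ₀`. -/
def NewFlag (G : SimpleGraph V) (φ₀ : Coloring V) (v : V) (φ : Coloring V) : Prop :=
  ∃ u, G.Adj v u ∧ φ s(v, u) = Status.flg ∧ φ₀ s(v, u) ≠ Status.flg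

variable {B : Set (Sym2 V)} {Q C : Finset ℕ} {x y : V} {q ℓ : ℕ}

theorem RoundState.blank_self (h : RoundState G φ₀ B Q φ x y) : φ s(x, y) = Status.blank :=
  (h.blank _ h.adj).2 (Or.inr rfl)

variable [DecidableEq V]

theorem RoundState.flagged (h : RoundState G φ₀ B Q φ x y) :
    Outcome G φ₀ B (Function.update φ s(x, y) Status.flg) := by
  refine ⟨h.proper.update _ (by simp), fun e he => ?_, s(x, y), fun e he hne hflg => ?_⟩
  · by_cases hxy : e = s(x, y)
    · subst hxy
      simp [h.notMem]
    · rw [Function.update_of_ne hxy, h.blank e he]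
      simp [hxy]
  · rw [Function.update_of_ne hne] at hflg
    exact (h.flag e he).1 hflg

theorem RoundState.newFlag_flagged (h : RoundState G φ₀ B Q φ x y) {v : V}
    (hv : NewFlag G φ₀ v (Function.update φ s(x, y) Status.flg)) : x = v ∨ y = v := by
  obtain ⟨u, hu, h1, h2⟩ := hv
  by_cases hxy : s(v, u) = s(x, y)
  · rcases Sym2.eq_iff.1 hxy with ⟨h3, -⟩ | ⟨h3, -⟩
    · exact Or.inl h3.symm
    · exact Or.inr h3.symm
  · rw [Function.update_of_ne hxy] at h1
    exact absurd ((h.flag _ hu).1 h1) h2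

/-- A set of edges has twice as many orientations as elements. -/
theorem two_mul_card_le [Fintype V] {U : Finset (Sym2 V)} (hU : ∀ e ∈ U, e ∈ G.edgeSet) :
    2 * U.card ≤ Fintype.card {p : V × V // s(p.1, p.2) ∈ U} := by
  rw [Fintype.card_subtype]
  rw [Finset.card_eq_sum_card_fiberwise (f := fun p : V × V => s(p.1, p.2)) (t := U)
    (fun p hp => by simpa using hp), mul_comm, ← smul_eq_mul]
  refine Finset.card_nsmul_le_sum _ _ _ fun e he => ?_
  induction e with
  | _ a b =>
    have hab : G.Adj a b := hU _ he
    rw [← Finset.card_pair (a := (a, b)) (b := (b, a)) (by simp [hab.ne])]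
    refine Finset.card_le_card fun p hp => ?_
    rw [Finset.mem_insert, Finset.mem_singleton] at hp
    rcases hp with rfl | rfl <;> simp [he, Sym2.eq_swap]

variable [Fintype V] [DecidableRel G.Adj]

theorem RoundState.augment (h : RoundState G φ₀ B Q φ x y) (hℓ : 1 ≤ ℓ) {K : VizingChain V}
    (hK : vizingChain G q φ x y C ℓ = some K) (hlen : K.path.length - 1 < ℓ) :
    Outcome G φ₀ B (augment φ x K) ∧ ∀ v, ¬ NewFlag G φ₀ v (augment φ x K) := by
  obtain ⟨h1, h2, c, -, h3⟩ :=
    (isVizingChain_of_eq_some h.adj hK).augment h.proper h.blank_self hℓ hlen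
  have hflag : ∀ e ∈ G.edgeSet, EdgeColoring.augment φ x K e = Status.flg →
      φ₀ e = Status.flg := by
    intro e he hflg
    by_cases hxy : e = s(x, y)
    · rw [hxy, h3] at hflg
      cases hflg
    · exact (h.flag e he).1 ((h2 e hxy).flg_iff.1 hflg)
  refine ⟨⟨h1, fun e he => ?_, s(x, y), fun e he _ => hflag e he⟩, ?_⟩
  · by_cases hxy : e = s(x, y)
    · rw [hxy, h3]
      simp [h.notMem]
    · rw [(h2 e hxy).blank_iff, h.blank e he]
      simp [hxy]
  · rintro v ⟨u, hu, h4, h5⟩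
    exact h5 (hflag _ hu h4)

theorem RoundState.moveUncolored (h : RoundState G φ₀ B Q φ x y) {ℓ' : ℕ}
    (hℓ' : ℓ' ∈ Finset.Icc 1 ℓ) {K : VizingChain V} (hK : vizingChain G q φ x y C ℓ = some K)
    (hlen : ¬ K.path.length - 1 < ℓ) :
    RoundState G φ₀ B (Q \ C) (moveUncolored φ x K ℓ') (K.path.getD (ℓ' - 1) x)
      (K.path.getD ℓ' x) := by
  rw [Finset.mem_Icc] at hℓ'
  obtain ⟨a, b, ha, hb, hab, ⟨c, hc, hcol⟩, h1, h2, h3, d, hd, h4⟩ :=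
    (isVizingChain_of_eq_some h.adj hK).moveUncolored h.proper h.blank_self hℓ'.1 hℓ'.2 hlen
  rw [List.getD_eq_getElem?_getD, List.getD_eq_getElem?_getD, ha, hb, Option.getD_some,
    Option.getD_some]
  have hne : s(a, b) ≠ s(x, y) := by
    intro e
    rw [e, h.blank_self] at hcol
    cases hcol
  refine ⟨hab, h1, fun hB => ?_, fun e he => ?_, fun e he => ?_, fun c' hc' e he => ?_⟩
  · rw [(h.blank _ hab).2 (Or.inl hB)] at hcol
    cases hcol
  · by_cases e1 : e = s(a, b)
    · simp [e1, h2]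
    by_cases e2 : e = s(x, y)
    · rw [e2, h4]
      simp [h.notMem, hne.symm]
    · rw [(h3 e e2 e1).blank_iff, h.blank e he]
      simp [e1, e2]
  · by_cases e1 : e = s(a, b)
    · rw [e1, h2, ← h.flag _ hab, hcol]
      simp
    by_cases e2 : e = s(x, y)
    · rw [e2, h4, ← h.flag _ h.adj, h.blank_self]
      simp
    · rw [(h3 e e2 e1).flg_iff, h.flag e he]
  · rw [Finset.mem_sdiff] at hc'
    by_cases e1 : e = s(a, b)
    · rw [e1, h2, ← h.color c' hc'.1 _ hab, hcol]
      simp only [reduceCtorEq, Status.color.injEq, false_iff]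
      rintro rfl
      exact hc'.2 hc
    by_cases e2 : e = s(x, y)
    · rw [e2, h4, ← h.color c' hc'.1 _ h.adj, h.blank_self]
      simp only [reduceCtorEq, Status.color.injEq, iff_false]
      rintro rfl
      exact hc'.2 hd
    · rw [(h3 e e2 e1).color_iff hc'.2, h.color c' hc'.1 e he]

theorem colorOneLoop_outcome {κ : ℕ} (hℓ : 1 ≤ ℓ) (t : ℕ) :
    ∀ {φ : Coloring V} {Q : Finset ℕ} {x y : V}, RoundState G φ₀ B Q φ x y →
      κ * t < Q.card → ∀ φ' ∈ (colorOneLoop G q κ ℓ t φ Q x y).support, Outcome G φ₀ B φ' := by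
  induction t with
  | zero =>
    intro φ Q x y h _ φ' hφ'
    simp only [colorOneLoop, PMF.support_pure, Set.mem_singleton_iff] at hφ'
    exact hφ' ▸ h.flagged
  | succ t ih =>
    intro φ Q x y h hcard φ' hφ'
    have hne : Q.Nonempty := Finset.card_pos.1 (by omega)
    rw [colorOneLoop, PMF.mem_support_bind_iff] at hφ'
    obtain ⟨C, hC, hφ'⟩ := hφ'
    obtain ⟨hCQ, hCκ⟩ := samplePalette_support hne κ C hC
    rcases hK : vizingChain G q φ x y C ℓ with _ | K
    · simp only [hK, PMF.support_pure, Set.mem_singleton_iff] at hφ'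
      exact hφ' ▸ h.flagged
    · simp only [hK] at hφ'
      split_ifs at hφ' with hlen
      · simp only [PMF.support_pure, Set.mem_singleton_iff] at hφ'
        exact hφ' ▸ (h.augment hℓ hK hlen).1
      · rw [PMF.mem_support_bind_iff] at hφ'
        obtain ⟨ℓ', hℓ', hφ'⟩ := hφ'
        have hmem := mem_of_mem_support_uniformOn (Finset.nonempty_Icc.2 hℓ) hℓ'
        refine ih (h.moveUncolored hmem hK hlen) ?_ φ' hφ'
        have h1 := Finset.le_card_sdiff C Q
        have h2 : κ * (t + 1) = κ * t + κ := by ring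
        omega

open Classical in
/-- The palettes of the later rounds avoid the earlier ones, and therefore the positions of the
uncolored edge are determined by the palettes and the original coloring `φ₀`. -/
theorem expect_newFlag_le {κ : ℕ} (hℓ : 1 ≤ ℓ) (v : V) (t : ℕ) :
    ∀ {φ : Coloring V} {Q : Finset ℕ} {x y : V}, RoundState G φ₀ B Q φ x y →
      κ * t < Q.card →
      expect (colorOneLoop G q κ ℓ t φ Q x y) (fun φ' => if NewFlag G φ₀ v φ' then 1 else 0) ≤
        flagMass G q κ ℓ φ₀ v t Q x y := by
  have hflag : ∀ {φ : Coloring V} {Q : Finset ℕ} {x y : V}, RoundState G φ₀ B Q φ x y →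
      (if NewFlag G φ₀ v (Function.update φ s(x, y) Status.flg) then 1 else 0) ≤
        touch v x y := by
    intro φ Q x y h
    split_ifs with hv
    · rcases h.newFlag_flagged hv with e | e
      · simp [touch, e]
      · simp [touch, e]
    · exact zero_le
  induction t with
  | zero =>
    intro φ Q x y h _
    rw [colorOneLoop, expect_pure, flagMass]
    exact hflag h
  | succ t ih =>
    intro φ Q x y h hcard
    have hne : Q.Nonempty := Finset.card_pos.1 (by omega)
    rw [colorOneLoop, expect_bind, flagMass]
    refine expect_mono fun C hC => ?_
    obtain ⟨hCQ, hCκ⟩ := samplePalette_support hne κ C hC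
    have hcongr : vizingChain G q φ x y C ℓ = vizingChain G q φ₀ x y C ℓ :=
      vizingChain_congr (fun c hc => h.color c (hCQ hc)) x y ℓ
    rw [← hcongr, moveExpect, ← hcongr]
    rcases hK : vizingChain G q φ x y C ℓ with _ | K
    · simp only [if_true, expect_pure]
      exact (hflag h).trans le_self_add
    · simp only [reduceCtorEq, if_false, zero_add]
      by_cases hlen : K.path.length - 1 < ℓ
      · simp only [if_pos hlen, expect_pure]
        rw [if_neg ((h.augment hℓ hK hlen).2 v)]
      · simp only [if_neg hlen, expect_bind]
        refine expect_mono fun ℓ' hℓ' => ?_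
        have hmem := mem_of_mem_support_uniformOn (Finset.nonempty_Icc.2 hℓ) hℓ'
        refine ih (h.moveUncolored hmem hK hlen) ?_
        have h1 := Finset.le_card_sdiff C Q
        have h2 : κ * (t + 1) = κ * t + κ := by ring
        omega

/-! ### The number of flags at a vertex -/

open Classical in
theorem Outcome.pow_degree_le {φ' : Coloring V} (h : Outcome G φ₀ B φ') (v : V) :
    (2 : ℝ≥0∞) ^ (flaggedGraph G φ').degree v ≤
      2 ^ (flaggedGraph G φ₀).degree v * (1 + if NewFlag G φ₀ v φ' then 1 else 0) := by
  obtain ⟨f, hf⟩ := h.flag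
  rw [← SimpleGraph.card_neighborFinset_eq_degree, ← SimpleGraph.card_neighborFinset_eq_degree]
  by_cases hnew : NewFlag G φ₀ v φ'
  · rw [if_pos hnew, one_add_one_eq_two, ← pow_succ]
    refine pow_le_pow_right₀ (by norm_num) ?_
    obtain ⟨u, hu, h1, h2⟩ := hnew
    have huf : s(v, u) = f := by
      by_contra hne
      exact h2 (hf _ hu hne h1)
    refine (Finset.card_le_card (t := insert u ((flaggedGraph G φ₀).neighborFinset v)) ?_).trans
      (Finset.card_insert_le _ _)
    intro z hz
    rw [SimpleGraph.mem_neighborFinset] at hz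
    rw [Finset.mem_insert, SimpleGraph.mem_neighborFinset]
    by_cases hzf : s(v, z) = f
    · exact Or.inl (Sym2.congr_right.1 (hzf.trans huf.symm))
    · exact Or.inr ⟨hz.1, hf _ hz.1 hzf hz.2⟩
  · rw [if_neg hnew, add_zero, mul_one]
    refine pow_le_pow_right₀ (by norm_num) (Finset.card_le_card fun z hz => ?_)
    rw [SimpleGraph.mem_neighborFinset] at hz ⊢
    refine ⟨hz.1, ?_⟩
    by_contra hne
    exact hnew ⟨z, hz.1, hz.2, hne⟩

theorem sum_flagMass_initial_le (hφ : Proper G φ) {U : Finset (Sym2 V)}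
    (hU : ∀ e ∈ U, e ∈ G.edgeSet) {κ s T : ℕ} (hℓ : 1 ≤ ℓ)
    (hκℓ : (ℓ : ℝ≥0∞)⁻¹ * (2 * (κ : ℝ≥0∞) ^ 2) ≤ 2⁻¹) (hs : 1 ≤ s)
    (hq : G.maxDegree + s + κ * T ≤ q) {ρ : ℝ≥0∞}
    (hρ : (((G.maxDegree + s : ℕ) : ℝ≥0∞))⁻¹ * (G.maxDegree : ℝ≥0∞) ≤ ρ)
    (hfin : (G.maxDegree : ℝ≥0∞) *
      (4 * (((G.maxDegree : ℝ≥0∞) + 2) * ρ ^ κ) + 2 * 2⁻¹ ^ T) ≤ 2) (v : V) :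
    ∑ p : {p : V × V // s(p.1, p.2) ∈ U},
      flagMass G q κ ℓ φ v T (Finset.Icc 1 q) p.1.1 p.1.2 ≤ 2 := by
  have hrow : ∀ x, ∑ y, (if s(x, y) ∈ U then 1 else 0 : ℝ≥0∞) ≤ G.maxDegree := by
    intro x
    rw [Finset.sum_boole]
    refine Nat.cast_le.2 (le_trans ?_ (G.degree_le_maxDegree x))
    rw [← SimpleGraph.card_neighborFinset_eq_degree]
    refine Finset.card_le_card fun y hy => ?_
    rw [SimpleGraph.mem_neighborFinset]
    exact hU _ (Finset.mem_filter.1 hy).2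
  have hmain := sum_flagMass_le (q := q) hφ hℓ hκℓ hs hρ v T (Finset.Icc 1 q)
    (fun x y => if s(x, y) ∈ U then 1 else 0) G.maxDegree le_rfl (by simpa using hq) hrow
    (fun y => by simpa only [Sym2.eq_swap] using hrow y)
  refine le_trans (le_of_eq ?_) (hmain.trans hfin)
  rw [← Fintype.sum_prod_type' (f := fun x y => (if s(x, y) ∈ U then 1 else 0) *
    flagMass G q κ ℓ φ v T (Finset.Icc 1 q) x y)]
  simp only [ite_mul, one_mul, zero_mul]
  rw [← Finset.sum_filter]
  exact (Finset.sum_subtype _ (by simp) fun p : V × V =>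
    flagMass G q κ ℓ φ v T (Finset.Icc 1 q) p.1 p.2).symm

/-- The exponential moment of the number of flags at `v`. When `u` edges are left, a random one of
them leads to a new flag at `v` with probability at most `1 / u`, which increases the moment by the
factor `(u + 1) / u` at most. -/
theorem expect_mainLoop_le {κ s T : ℕ} (hℓ : 1 ≤ ℓ)
    (hκℓ : (ℓ : ℝ≥0∞)⁻¹ * (2 * (κ : ℝ≥0∞) ^ 2) ≤ 2⁻¹) (hs : 1 ≤ s)
    (hq : G.maxDegree + s + κ * T ≤ q) {ρ : ℝ≥0∞}
    (hρ : (((G.maxDegree + s : ℕ) : ℝ≥0∞))⁻¹ * (G.maxDegree : ℝ≥0∞) ≤ ρ)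
    (hfin : (G.maxDegree : ℝ≥0∞) *
      (4 * (((G.maxDegree : ℝ≥0∞) + 2) * ρ ^ κ) + 2 * 2⁻¹ ^ T) ≤ 2) (v : V)
    (φ : Coloring V) (U : Finset (Sym2 V)) (hφ : Proper G φ) (hU : ∀ e ∈ U, e ∈ G.edgeSet)
    (hblank : ∀ e ∈ G.edgeSet, φ e = Status.blank ↔ e ∈ U) :
    expect (mainLoop G q κ ℓ T φ U) (fun φ' => 2 ^ (flaggedGraph G φ').degree v) ≤
      2 ^ (flaggedGraph G φ).degree v * (U.card + 1) := by
  classical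
  induction hn : U.card generalizing φ U with
  | zero =>
    rw [Finset.card_eq_zero] at hn
    subst hn
    rw [mainLoop, dif_neg (by simp), expect_pure]
    simp
  | succ n ih =>
    have hne : U.Nonempty := Finset.card_pos.1 (by omega)
    rw [mainLoop, dif_pos hne, expect_bind]
    have := nonempty_oriented hne
    have hstep : ∀ p : {p : V × V // s(p.1, p.2) ∈ U},
        expect ((colorOne G q κ ℓ T φ p.1.1 p.1.2).bind fun φ' =>
          mainLoop G q κ ℓ T φ' (U.erase s(p.1.1, p.1.2)))
          (fun φ' => 2 ^ (flaggedGraph G φ').degree v) ≤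
        2 ^ (flaggedGraph G φ).degree v * (n + 1) *
          (1 + flagMass G q κ ℓ φ v T (Finset.Icc 1 q) p.1.1 p.1.2) := by
      rintro ⟨⟨x, y⟩, hxy⟩
      simp only at hxy ⊢
      have hst : RoundState G φ (U.erase s(x, y) : Finset (Sym2 V)) (Finset.Icc 1 q) φ x y := by
        refine ⟨hU _ hxy, hφ, by simp, fun e he => ?_, fun _ _ => Iff.rfl, fun _ _ _ _ => Iff.rfl⟩
        rw [hblank e he, Finset.mem_coe, Finset.mem_erase]
        by_cases h : e = s(x, y)
        · simp [h, hxy]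
        · simp [h]
      have hcard : κ * T < (Finset.Icc 1 q).card := by
        rw [Nat.card_Icc]
        omega
      rw [expect_bind]
      have h1 : ∀ φ' ∈ (colorOne G q κ ℓ T φ x y).support,
          expect (mainLoop G q κ ℓ T φ' (U.erase s(x, y)))
            (fun φ' => 2 ^ (flaggedGraph G φ').degree v) ≤
          2 ^ (flaggedGraph G φ).degree v * (n + 1) *
            (1 + if NewFlag G φ v φ' then 1 else 0) := by
        intro φ' hφ'
        have hout := colorOneLoop_outcome hℓ T hst hcard φ' hφ'
        have h2 := ih φ' (U.erase s(x, y)) hout.proper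
          (fun e he => hU e (Finset.mem_of_mem_erase he)) hout.blank
          (by rw [Finset.card_erase_of_mem hxy, hn, Nat.add_sub_cancel])
        refine h2.trans ?_
        refine (mul_le_mul_left (hout.pow_degree_le v) _).trans (le_of_eq ?_)
        ring
      refine (expect_mono h1).trans ?_
      rw [expect_mul_left, expect_add, expect_const]
      exact mul_le_mul_right (add_le_add le_rfl (expect_newFlag_le hℓ v T hst hcard)) _
    refine (expect_mono fun p _ => hstep p).trans ?_
    rw [expect_mul_left, expect_add, expect_const, PMF.uniformOfFintype, expect_uniformOfFinset]
    have hsum := sum_flagMass_initial_le hφ hU hℓ hκℓ hs hq hρ hfin v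
    have hcard2 := two_mul_card_le hU
    rw [hn] at hcard2
    have hprob : ((Finset.univ : Finset {p : V × V // s(p.1, p.2) ∈ U}).card : ℝ≥0∞)⁻¹ *
        ∑ p : {p : V × V // s(p.1, p.2) ∈ U},
          flagMass G q κ ℓ φ v T (Finset.Icc 1 q) p.1.1 p.1.2 ≤ ((n : ℝ≥0∞) + 1)⁻¹ := by
      calc _ ≤ (2 * ((n : ℝ≥0∞) + 1))⁻¹ * 2 := by
            refine mul_le_mul' (ENNReal.inv_le_inv.2 ?_) hsum
            rw [Finset.card_univ]
            exact_mod_cast hcard2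
        _ = ((n : ℝ≥0∞) + 1)⁻¹ := by
            rw [ENNReal.mul_inv (Or.inl (by norm_num)) (Or.inl (by norm_num)), mul_right_comm,
              ENNReal.inv_mul_cancel (by norm_num) (by norm_num), one_mul]
    refine (mul_le_mul_right (add_le_add le_rfl hprob) _).trans (le_of_eq ?_)
    rw [mul_assoc, mul_add, mul_one, ENNReal.mul_inv_cancel (by simp) (by finiteness)]
    push_cast
    ring

end ColorOne

/-! ### The size of the parameters -/

/-- The palettes of all rounds together, of size `κ T ≤ 100 a log² Δ / ε`, use up at most `ε Δ / 8`
colours; `L` stands for `log Δ`. -/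
theorem round_budget {a K Δ ε L : ℝ} (ha : 0 < a) (hε : 0 < ε) (hL : L = Real.log Δ)
    (hΔ : 0 < Δ) (hK : 13000 * a ≤ K) (hLa : 38400 * a ≤ L)
    (h : K * (1 / ε * Real.log (1 / ε)) ^ 2 ≤ Δ) : 800 * a * L ^ 2 ≤ ε ^ 2 * Δ := by
  have hL0 : 0 < L := by nlinarith
  rcases le_total (L / 4) (Real.log (1 / ε)) with hcase | hcase
  · have h1 : K * Real.log (1 / ε) ^ 2 ≤ ε ^ 2 * Δ := by
      calc K * Real.log (1 / ε) ^ 2 = ε ^ 2 * (K * (1 / ε * Real.log (1 / ε)) ^ 2) := by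
            field_simp
        _ ≤ ε ^ 2 * Δ := by gcongr
    have h2 : (L / 4) ^ 2 ≤ Real.log (1 / ε) ^ 2 := by gcongr
    have hK0 : 0 ≤ K := le_trans (by positivity) hK
    calc 800 * a * L ^ 2 = 12800 * a * (L / 4) ^ 2 := by ring
      _ ≤ K * (L / 4) ^ 2 := by
          refine mul_le_mul_of_nonneg_right ?_ (sq_nonneg _)
          linarith
      _ ≤ K * Real.log (1 / ε) ^ 2 := mul_le_mul_of_nonneg_left h2 hK0
      _ ≤ _ := h1
  · -- here `ε ≥ Δ ^ (-1/4)`, so that `ε² Δ ≥ Δ ^ (1/2)`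
    have h1 : -(L / 4) ≤ Real.log ε := by
      rw [one_div, Real.log_inv] at hcase
      linarith
    have h2 : Real.exp (-(L / 4)) ≤ ε := by
      rw [← Real.exp_log hε]
      exact Real.exp_le_exp.2 h1
    have h3 : Real.exp (L / 2) ≤ ε ^ 2 * Δ := by
      have e1 : Real.exp (L / 2) = Real.exp (-(L / 4)) ^ 2 * Δ := by
        rw [← Real.exp_log hΔ, ← hL, ← Real.exp_nat_mul, ← Real.exp_add]
        congr 1
        push_cast
        ring
      rw [e1]
      gcongr
    have h4 := Real.pow_div_factorial_le_exp (L / 2) (by positivity) 3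
    have h5 : 800 * a * L ^ 2 ≤ (L / 2) ^ 3 / (Nat.factorial 3 : ℝ) := by
      have e2 : (Nat.factorial 3 : ℝ) = 6 := by norm_num [Nat.factorial]
      rw [e2]
      have := mul_le_mul_of_nonneg_right hLa (sq_nonneg L)
      nlinarith
    linarith

theorem div_add_le_exp {Δ s ε : ℝ} (hΔ : 0 < Δ) (hε : 0 < ε) (hε1 : ε < 1) (hs : ε * Δ / 8 ≤ s) :
    (Δ + s)⁻¹ * Δ ≤ Real.exp (-(ε / 16)) := by
  have h1 : ε / 16 ≤ Real.log (1 + ε / 8) := by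
    refine le_trans ?_ (Real.one_sub_inv_le_log_of_pos (by positivity))
    have : 1 - (1 + ε / 8)⁻¹ = (ε / 8) / (1 + ε / 8) := by
      field_simp
      ring
    rw [this, le_div_iff₀ (by positivity)]
    nlinarith
  have h2 : Real.exp (ε / 16) ≤ 1 + ε / 8 := by
    rw [← Real.exp_log (show 0 < 1 + ε / 8 by positivity)]
    exact Real.exp_le_exp.2 h1
  have hs0 : 0 < Δ + s := by
    have : 0 < ε * Δ / 8 := by positivity
    linarith
  rw [Real.exp_neg, inv_mul_le_iff₀ hs0, ← div_eq_mul_inv, le_div_iff₀ (Real.exp_pos _)]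
  calc Δ * Real.exp (ε / 16) ≤ Δ * (1 + ε / 8) := by gcongr
    _ ≤ Δ + s := by linarith

/-- The total flag weight at a vertex is at most `2`. -/
theorem total_weight_le {Δ ε : ℝ} {κ T : ℕ} (hΔ : 100 ≤ Δ) (hε : 0 < ε)
    (hκ : 80 * (Real.log Δ / ε) ≤ κ) (hT : 100 * Real.log Δ - 1 ≤ T) :
    Δ * (4 * ((Δ + 2) * Real.exp (-(ε / 16)) ^ κ) + 2 * (2⁻¹ : ℝ) ^ T) ≤ 2 := by
  have hΔ0 : 0 < Δ := by linarith
  have hL : 0 < Real.log Δ := Real.log_pos (by linarith)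
  have h1 : Real.exp (-(ε / 16)) ^ κ ≤ (Δ ^ 5)⁻¹ := by
    have e : (Δ ^ 5)⁻¹ = Real.exp (-(5 * Real.log Δ)) := by
      rw [Real.exp_neg, show (5 : ℝ) * Real.log Δ = (5 : ℕ) * Real.log Δ by norm_num,
        Real.exp_nat_mul, Real.exp_log hΔ0]
    rw [← Real.exp_nat_mul, e, Real.exp_le_exp]
    have : 80 * Real.log Δ ≤ κ * ε := by
      rwa [mul_div_assoc', div_le_iff₀ hε] at hκ
    linarith
  have h2 : (2⁻¹ : ℝ) ^ T ≤ 2 * (Δ ^ 2)⁻¹ := by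
    have h3 : Real.exp (-(T * Real.log 2)) = (2⁻¹ : ℝ) ^ T := by
      rw [Real.exp_neg, Real.exp_nat_mul, Real.exp_log (by norm_num), inv_pow]
    have e : 2 * (Δ ^ 2)⁻¹ = Real.exp (Real.log 2 - 2 * Real.log Δ) := by
      rw [Real.exp_sub, Real.exp_log (by norm_num),
        show (2 : ℝ) * Real.log Δ = (2 : ℕ) * Real.log Δ by norm_num,
        Real.exp_nat_mul, Real.exp_log hΔ0, div_eq_mul_inv]
    rw [← h3, e, Real.exp_le_exp]
    have hlog2 : 0.6931471803 < Real.log 2 := Real.log_two_gt_d9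
    nlinarith
  have h4 : Δ * (4 * ((Δ + 2) * (Δ ^ 5)⁻¹)) ≤ 1 := by
    have : Δ * (4 * ((Δ + 2) * (Δ ^ 5)⁻¹)) = 4 * (Δ + 2) / Δ ^ 4 := by
      field_simp
    rw [this, div_le_one (by positivity)]
    nlinarith [pow_le_pow_left₀ (by norm_num) hΔ 3, pow_le_pow_left₀ (by norm_num) hΔ 4]
  have h5 : Δ * (2 * (2 * (Δ ^ 2)⁻¹)) ≤ 1 := by
    have : Δ * (2 * (2 * (Δ ^ 2)⁻¹)) = 4 / Δ := by
      field_simp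
      norm_num
    rw [this, div_le_one hΔ0]
    linarith
  calc Δ * (4 * ((Δ + 2) * Real.exp (-(ε / 16)) ^ κ) + 2 * (2⁻¹ : ℝ) ^ T)
      ≤ Δ * (4 * ((Δ + 2) * (Δ ^ 5)⁻¹) + 2 * (2 * (Δ ^ 2)⁻¹)) := by gcongr
    _ = Δ * (4 * ((Δ + 2) * (Δ ^ 5)⁻¹)) + Δ * (2 * (2 * (Δ ^ 2)⁻¹)) := by ring
    _ ≤ 2 := by linarith

theorem cube_mul_two_rpow_le {n ε Δ A K : ℝ} (hn : 2 ≤ n) (hK : 9 * (A + 3) ≤ K)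
    (h : K * Real.log n ≤ ε * Δ) (hA : 0 < A) :
    n * n ^ 2 * (2 : ℝ) ^ (-(ε * Δ / 6)) ≤ n ^ (-A) := by
  have hn0 : 0 < n := by linarith
  have hlogn : 0 < Real.log n := Real.log_pos (by linarith)
  have hlog2 : 0.6931471803 < Real.log 2 := Real.log_two_gt_d9
  have e1 : n * n ^ 2 = n ^ (3 : ℝ) := by
    rw [show (3 : ℝ) = ((3 : ℕ) : ℝ) by norm_num, Real.rpow_natCast]
    ring
  rw [e1, Real.rpow_def_of_pos hn0, Real.rpow_def_of_pos hn0,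
    Real.rpow_def_of_pos (by norm_num : (0 : ℝ) < 2), ← Real.exp_add, Real.exp_le_exp]
  have h1 : 9 * (A + 3) * Real.log n ≤ ε * Δ :=
    (mul_le_mul_of_nonneg_right hK hlogn.le).trans h
  have h2 : 0 < (A + 3) * Real.log n := by positivity
  nlinarith

/-! ### The failure event -/

section Fail

variable {V : Type*} [Fintype V] {G : SimpleGraph V} [DecidableRel G.Adj]

/-- If the number `N` of flags at every vertex satisfies `E[2 ^ N] ≤ M`, then the algorithm fails
with probability at most `n M 2 ^ (-ε Δ / 6)`. -/
theorem toOuterMeasure_failEvent_le [Nonempty V] (p : PMF (Coloring V)) (ε : ℝ) {M : ℝ≥0∞}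
    (h : ∀ v, expect p (fun φ => 2 ^ (flaggedGraph G φ).degree v) ≤ M) :
    p.toOuterMeasure (failEvent G ε) ≤
      Fintype.card V * M * ENNReal.ofReal ((2 : ℝ) ^ (-(ε * G.maxDegree / 6))) := by
  classical
  rw [toOuterMeasure_eq_expect]
  set c := ENNReal.ofReal ((2 : ℝ) ^ (-(ε * G.maxDegree / 6))) with hc
  have h1 : ∀ φ ∈ p.support, (if φ ∈ failEvent G ε then 1 else 0 : ℝ≥0∞) ≤
      ∑ v, c * 2 ^ (flaggedGraph G φ).degree v := by
    intro φ _
    split_ifs with hφ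
    · obtain ⟨v, hv⟩ := (flaggedGraph G φ).exists_maximal_degree_vertex
      have hφ' : ε * G.maxDegree / 6 < ((flaggedGraph G φ).maxDegree : ℝ) := hφ
      rw [hv] at hφ'
      refine le_trans ?_ (Finset.single_le_sum
        (f := fun v => c * 2 ^ (flaggedGraph G φ).degree v) (fun _ _ => zero_le)
        (Finset.mem_univ v))
      have e : (2 : ℝ≥0∞) ^ (flaggedGraph G φ).degree v =
          ENNReal.ofReal ((2 : ℝ) ^ (flaggedGraph G φ).degree v) := by
        rw [ENNReal.ofReal_pow (by norm_num)]
        norm_num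
      simp only [e, hc]
      rw [← ENNReal.ofReal_mul (by positivity), ENNReal.one_le_ofReal, ← Real.rpow_natCast,
        ← Real.rpow_add (by norm_num)]
      exact Real.one_le_rpow (by norm_num) (by linarith)
    · exact zero_le
  refine (expect_mono h1).trans ?_
  rw [expect_sum]
  simp only [expect_mul_left]
  refine (Finset.sum_le_card_nsmul _ _ (c * M) fun v _ => mul_le_mul_right (h v) c).trans ?_
  rw [nsmul_eq_mul, Finset.card_univ, mul_comm c, mul_assoc]

theorem card_edgeFinset_add_one_le (hV : 1 ≤ Fintype.card V) :
    G.edgeFinset.card + 1 ≤ Fintype.card V ^ 2 := by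
  have h1 := G.card_edgeFinset_le_card_choose_two
  have h2 : (Fintype.card V).choose 2 + 1 ≤ Fintype.card V ^ 2 := by
    rw [Nat.choose_two_right]
    obtain ⟨m, hm⟩ : ∃ m, Fintype.card V = m + 1 := ⟨Fintype.card V - 1, by omega⟩
    rw [hm, Nat.add_sub_cancel]
    have h3 : (m + 1) * m / 2 ≤ (m + 1) * m := Nat.div_le_self _ _
    nlinarith
  omega

theorem two_le_card_of_maxDegree_pos (h : 0 < G.maxDegree) : 2 ≤ Fintype.card V := by
  by_contra hcon
  have : G.maxDegree ≤ 0 := by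
    refine G.maxDegree_le_of_forall_degree_le 0 fun v => ?_
    have := G.degree_lt_card_verts v
    omega
  omega

end Fail

end EdgeColoring

theorem proposition4p1 :
    ∃ a₀ b₀ : ℝ, 0 < a₀ ∧ 0 < b₀ ∧
      ∀ a₁ b₁ : ℝ, a₀ ≤ a₁ → b₀ ≤ b₁ → ∀ A : ℝ, 0 < A →
      ∃ K : ℝ, 0 < K ∧
        ∀ (V : Type*) [Fintype V] [DecidableEq V] (G : SimpleGraph V) [DecidableRel G.Adj]
          (n Δ : ℕ) (ε : ℝ) (κ ℓ : ℕ),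
          Fintype.card V = n → G.maxDegree = Δ →
          0 < ε → ε < 1 →
          K * max (Real.log n / ε) ((1 / ε * Real.log (1 / ε)) ^ 2) ≤ (Δ : ℝ) →
          a₀ * (Real.log Δ / ε) ≤ (κ : ℝ) → (κ : ℝ) ≤ a₁ * (Real.log Δ / ε) →
          b₀ * (κ : ℝ) ^ 2 ≤ (ℓ : ℝ) → (ℓ : ℝ) ≤ b₁ * (κ : ℝ) ^ 2 →
          (EdgeColoring.stageOne G ε κ ℓ).toOuterMeasure (EdgeColoring.failEvent G ε) ≤
            ENNReal.ofReal ((n : ℝ) ^ (-A)) := by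
  refine ⟨80, 4, by norm_num, by norm_num, fun a₁ b₁ ha₁ _ A hA => ?_⟩
  -- the summands serve the number of colours, `log Δ ≥ 38400 a₁`, `ε Δ ≥ 100`, and the union bound
  refine ⟨13000 * a₁ + 2 * Real.exp (38400 * a₁) + 200 + 9 * (A + 3), by positivity, ?_⟩
  set K := 13000 * a₁ + 2 * Real.exp (38400 * a₁) + 200 + 9 * (A + 3) with hKdef
  intro V _ _ G _ n Δ ε κ ℓ hn hΔ hε hε1 hK hκ hκ' hℓ _
  have hexp := Real.exp_pos (38400 * a₁)
  have hK0 : 0 < K := by positivity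
  have hΔpos : (0 : ℝ) < Δ := by
    refine lt_of_lt_of_le (mul_pos hK0 (lt_max_of_lt_right ?_)) hK
    have : 0 < Real.log (1 / ε) := Real.log_pos (by rwa [one_div, one_lt_inv₀ hε])
    positivity
  have hn2 : 2 ≤ n := by
    rw [← hn]
    refine EdgeColoring.two_le_card_of_maxDegree_pos (G := G) ?_
    rw [hΔ]
    exact_mod_cast hΔpos
  have hn2' : (2 : ℝ) ≤ n := by exact_mod_cast hn2
  have : Nonempty V := Fintype.card_pos_iff.1 (by omega)
  have hlog2 : 0.6931471803 < Real.log 2 := Real.log_two_gt_d9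
  have hlogn : 0.6931471803 < Real.log n :=
    hlog2.trans_le (Real.log_le_log (by norm_num) hn2')
  have hK1 : K * Real.log n ≤ ε * Δ := by
    have := (mul_le_mul_of_nonneg_left (le_max_left _ _) hK0.le).trans hK
    rw [mul_div_assoc', div_le_iff₀ hε] at this
    linarith
  have hK2 : K * (1 / ε * Real.log (1 / ε)) ^ 2 ≤ Δ :=
    (mul_le_mul_of_nonneg_left (le_max_right _ _) hK0.le).trans hK
  have hK69 : K * 0.6931471803 ≤ ε * Δ := (mul_le_mul_of_nonneg_left hlogn.le hK0.le).trans hK1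
  have hεΔ : ε * Δ ≤ Δ := by nlinarith
  have hεΔ100 : 100 ≤ ε * Δ := by linarith
  have hL : 38400 * a₁ ≤ Real.log Δ := by
    rw [Real.le_log_iff_exp_le hΔpos]
    linarith
  have hL0 : 0 < Real.log Δ := by linarith
  have hbudget := EdgeColoring.round_budget (a := a₁) (by linarith) hε rfl hΔpos (by linarith)
    hL hK2
  have hκ0 : (0 : ℝ) < κ := lt_of_lt_of_le (by positivity) hκ
  have hℓ0 : (0 : ℝ) < ℓ := lt_of_lt_of_le (by positivity) hℓ
  have hℓ1 : 1 ≤ ℓ := by exact_mod_cast hℓ0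
  set T := ⌊100 * Real.log (Δ : ℝ)⌋₊ with hT
  have hTle : (T : ℝ) ≤ 100 * Real.log Δ := Nat.floor_le (by positivity)
  have hTge : 100 * Real.log Δ - 1 ≤ T := by
    have := Nat.lt_floor_add_one (100 * Real.log (Δ : ℝ))
    linarith
  set s := ⌈ε * (Δ : ℝ) / 8⌉₊ with hs
  have hsge : ε * (Δ : ℝ) / 8 ≤ s := Nat.le_ceil _
  have hsle : (s : ℝ) < ε * (Δ : ℝ) / 8 + 1 := Nat.ceil_lt_add_one (by positivity)
  have hs1 : 1 ≤ s := Nat.ceil_pos.2 (by positivity)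
  have hκT : (κ : ℝ) * T ≤ ε * Δ / 8 := by
    calc (κ : ℝ) * T ≤ a₁ * (Real.log Δ / ε) * (100 * Real.log Δ) := by
          gcongr
      _ = (800 * a₁ * Real.log Δ ^ 2) / (8 * ε) := by
          field_simp
          ring
      _ ≤ (ε ^ 2 * Δ) / (8 * ε) := by gcongr
      _ = ε * Δ / 8 := by
          field_simp
  have hq : G.maxDegree + s + κ * T ≤ ⌊(1 + ε / 2) * (Δ : ℝ)⌋₊ := by
    refine Nat.le_floor ?_
    push_cast
    rw [hΔ]
    linarith
  have hκℓ : (ℓ : ENNReal)⁻¹ * (2 * (κ : ENNReal) ^ 2) ≤ 2⁻¹ := by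
    have h1 : (2 : ENNReal) * (2 * (κ : ENNReal) ^ 2) ≤ ℓ := by
      have : 4 * κ ^ 2 ≤ ℓ := by exact_mod_cast hℓ
      rw [← mul_assoc]
      norm_num
      exact_mod_cast this
    rw [ENNReal.le_inv_iff_mul_le, mul_assoc]
    calc _ ≤ (ℓ : ENNReal)⁻¹ * ℓ := by
          refine mul_le_mul_right ?_ _
          rwa [mul_comm]
      _ ≤ 1 := ENNReal.inv_mul_le_one _
  have hρ : (((G.maxDegree + s : ℕ) : ENNReal))⁻¹ * (G.maxDegree : ENNReal) ≤
      ENNReal.ofReal (Real.exp (-(ε / 16))) := by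
    rw [hΔ]
    refine le_trans (le_of_eq ?_) (ENNReal.ofReal_le_ofReal
      (EdgeColoring.div_add_le_exp hΔpos hε hε1 hsge))
    have hpos : (0 : ℝ) < (Δ : ℝ) + s := by positivity
    rw [ENNReal.ofReal_mul (by positivity), ENNReal.ofReal_inv_of_pos hpos,
      ← Nat.cast_add, ENNReal.ofReal_natCast, ENNReal.ofReal_natCast]
  have hfin : (G.maxDegree : ENNReal) * (4 * (((G.maxDegree : ENNReal) + 2) *
      ENNReal.ofReal (Real.exp (-(ε / 16))) ^ κ) + 2 * 2⁻¹ ^ T) ≤ 2 := by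
    rw [hΔ]
    have h1 := ENNReal.ofReal_le_ofReal
      (EdgeColoring.total_weight_le (κ := κ) (T := T) (hεΔ100.trans hεΔ) hε hκ hTge)
    refine le_trans (le_of_eq ?_) (h1.trans (by simp))
    rw [ENNReal.ofReal_mul hΔpos.le, ENNReal.ofReal_add (by positivity) (by positivity),
      ENNReal.ofReal_mul (by norm_num), ENNReal.ofReal_mul (by positivity),
      ENNReal.ofReal_add hΔpos.le (by norm_num), ENNReal.ofReal_pow (Real.exp_pos _).le,
      ENNReal.ofReal_mul (by norm_num), ENNReal.ofReal_pow (by norm_num),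
      ENNReal.ofReal_inv_of_pos (by norm_num)]
    simp
  have hmoment : ∀ v, EdgeColoring.expect (EdgeColoring.stageOne G ε κ ℓ)
      (fun φ => 2 ^ (EdgeColoring.flaggedGraph G φ).degree v) ≤ ((n ^ 2 : ℕ) : ENNReal) := by
    intro v
    have h1 := EdgeColoring.expect_mainLoop_le (G := G) (q := ⌊(1 + ε / 2) * (Δ : ℝ)⌋₊)
      hℓ1 hκℓ hs1 hq hρ hfin v (fun _ => EdgeColoring.Status.blank) G.edgeFinset
      (fun _ _ _ _ _ _ h => by cases h) (by simp) (by simp)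
    have hdeg : (EdgeColoring.flaggedGraph G
        (fun _ => EdgeColoring.Status.blank)).degree v = 0 := by
      rw [← SimpleGraph.card_neighborFinset_eq_degree, Finset.card_eq_zero,
        Finset.eq_empty_iff_forall_notMem]
      intro u hu
      rw [SimpleGraph.mem_neighborFinset] at hu
      exact absurd hu.2 (by simp)
    rw [hdeg, pow_zero, one_mul] at h1
    rw [EdgeColoring.stageOne, hΔ]
    refine h1.trans ?_
    have := EdgeColoring.card_edgeFinset_add_one_le (G := G) (by omega)
    rw [hn] at this
    exact_mod_cast this
  refine (EdgeColoring.toOuterMeasure_failEvent_le _ ε hmoment).trans ?_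
  rw [hn, hΔ]
  refine le_trans (le_of_eq ?_) (ENNReal.ofReal_le_ofReal
    (EdgeColoring.cube_mul_two_rpow_le hn2' (by linarith) hK1 hA))
  rw [ENNReal.ofReal_mul (by positivity), ENNReal.ofReal_mul (by positivity),
    ENNReal.ofReal_natCast, ← Nat.cast_pow, ENNReal.ofReal_natCast]
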